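/- Let $W=\{P(y|x)\}$ be a discrete memoryless channel with finite alphabets $\mathcal X,\mathcal Y$, let $R>0$, let $L\ge 1$ be a fixed integer, and let $Q$ be a probability distribution on $\mathcal X$. For a channel $V=\tilde P_{Y|X}$ from $\mathcal X$ to $\mathcal Y$ let $D(V\|W|Q)=\sum_x Q(x)\sum_y V(y|x)\ln\frac{V(y|x)}{W(y|x)}\in[0,\infty]$, and let $I(Q,V)$ be the mutual information (in nats) of $X\sim Q$ and the output $Y$ of $V$. Put $$E(R,L,Q)=\min_{V}\{D(V\|W|Q)+L\,[I(Q,V)-R]_+\},\qquad [t]_+=\max\{0,t\}.$$ Let $n$ run through a sequence of block lengths tending to infinity, and let $Q_n$ be empirical distributions of sequences of length $n$ with $Q_n\to Q$ (for instance $Q_n=Q$ for all $n$ in the sequence, if $Q$ is a type for these $n$). Let $M=\lfloor e^{nR}\rfloor+1$, and let the $M$ codewords be drawn independently and uniformly from the type class $\mathcal T(Q_n)\subseteq\mathcal X^n$. The messages are equiprobable. A list decoder of list size $L$ knows the codebook and maps each channel output $\mathbf y\in\mathcal Y^n$ to a set of exactly $L$ messages (possible once $n$ is so large that $L\le M$);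 its average list-error probability $\overline{P_e}$ is the probability, averaged over messages and random codebooks, that the transmitted message is not in the list. The ML list decoder lists $L$ messages with the largest $W^n(\mathbf y|\mathbf x_m)=\prod_i W(y_i|x_{m,i})$, and the MMI list decoder lists $L$ messages with the largest empirical mutual information $\hat I_{\mathbf x_m\mathbf y}(X;Y)$; ties are broken arbitrarily. Write $a_n\doteq b_n$ if $a_n,b_n>0$ for all large $n$ and $\frac1n\ln\frac{a_n}{b_n}\to0$. Then the minimum defining $E(R,L,Q)$ is attained and finite, and: 1. For the ML list decoder, $\overline{P_e}\doteq e^{-nE(R,L,Q)}$. 2. For the MMI list decoder, which does not depend on the channel, also $\overline{P_e}\doteq e^{-nE(R,L,Q)}$. Moreover no list decoder does better in the exponent: for every $\varepsilon>0$ and all sufficiently large $n$, every list decoder of list size $L$ has $\overline{P_e}\ge e^{-n(E(R,L,Q)+\varepsilon)}$. 3. The Gallager/Viterbi–Omura bound for this ensemble has the same exponent: $$\min_{0\le\rho\le L}M^{\rho}\sum_{\mathbf y\in\mathcal Y^n}\Big[\sum_{\mathbf x\in\mathcal T(Q_n)}\frac{1}{|\mathcal T(Q_n)|}\,W^n(\mathbf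 y|\mathbf x)^{1/(1+\rho)}\Big]^{1+\rho}\doteq e^{-nE(R,L,Q)}.$$ 4. With all maxima and minima attained, $$E(R,L,Q)=\max_{0\le\rho\le L}\min_{V}\{D(V\|W|Q)+\rho\,[I(Q,V)-R]\}=\min_{V}\max_{0\le\rho\le L}\{D(V\|W|Q)+\rho\,[I(Q,V)-R]\}.$$ -/

import Mathlib

open Filter Topology

namespace ListDecoding

/-- A stochastic matrix `W x y = W(y|x)`: a discrete memoryless channel with finite alphabets. -/
def IsChannel {X Y : Type*} [Fintype Y] (W : X → Y → ℝ) : Prop :=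
  ∀ x, W x ∈ stdSimplex ℝ Y

/-- The set of all channels from `X` to `Y`. -/
def channels (X Y : Type*) [Fintype Y] : Set (X → Y → ℝ) :=
  {V | IsChannel V}

/-- The memoryless extension `W(𝐲|𝐱) = ∏ᵢ W(yᵢ|xᵢ)`. -/
def seqProb {X Y : Type*} (W : X → Y → ℝ) {n : ℕ} (x : Fin n → X) (y : Fin n → Y) : ℝ :=
  ∏ i, W (x i) (y i)

/-- The empirical distribution (type) of a sequence. -/
noncomputable def empDist {A : Type*} [DecidableEq A] {n : ℕ} (x : Fin n → A) : A → ℝ :=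
  fun a => ((Finset.univ.filter (fun i => x i = a)).card : ℝ) / n

/-- The type class `T(Q)` in `Xⁿ`: all sequences with empirical distribution `Q`. -/
noncomputable def typeClass {X : Type*} [Fintype X] [DecidableEq X] (n : ℕ) (Q : X → ℝ) :
    Finset (Fin n → X) :=
  Finset.univ.filter (fun x => empDist x = Q)

/-- The fixed composition law of one codeword: uniform over `T(Q)`. -/
noncomputable def uniformTypeClass {X : Type*} [Fintype X] [DecidableEq X] (n : ℕ) (Q : X → ℝ)
    (x : Fin n → X) : ℝ :=
  if x ∈ typeClass n Q then 1 / ((typeClass n Q).card : ℝ) else 0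

/-- Mutual information (in nats) of a joint distribution on `X × Y`. -/
noncomputable def mutualInfo {X Y : Type*} [Fintype X] [Fintype Y] (P : X × Y → ℝ) : ℝ :=
  ∑ x, ∑ y, P (x, y) * Real.log (P (x, y) / ((∑ y', P (x, y')) * (∑ x', P (x', y))))

/-- The empirical mutual information of a pair of sequences. -/
noncomputable def empMutualInfo {X Y : Type*} [Fintype X] [Fintype Y] [DecidableEq X]
    [DecidableEq Y] {n : ℕ} (x : Fin n → X) (y : Fin n → Y) : ℝ :=
  mutualInfo (empDist (fun i => (x i, y i)))

/-- The mutual information `I(X;Y)` when `X ∼ Q` and `Y` is the output of `V`. -/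
noncomputable def inputChannelInfo {X Y : Type*} [Fintype X] [Fintype Y] (Q : X → ℝ)
    (V : X → Y → ℝ) : ℝ :=
  mutualInfo (fun p : X × Y => Q p.1 * V p.1 p.2)

/-- The conditional divergence `D(V‖W|Q)`, equal to `+∞` if, for some `x` of positive
`Q`-probability, `V(·|x)` is not absolutely continuous with respect to `W(·|x)`. -/
noncomputable def condDiv {X Y : Type*} [Fintype X] [Fintype Y] (V W : X → Y → ℝ)
    (Q : X → ℝ) : EReal :=
  if ∀ x y, 0 < Q x → W x y = 0 → V x y = 0 then
    ((∑ x, Q x * ∑ y, V x y * Real.log (V x y / W x y) : ℝ) : EReal)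
  else ⊤

/-- `D(V‖W|Q) + L [I(X;Y) - R]₊`. -/
noncomputable def listObjective {X Y : Type*} [Fintype X] [Fintype Y] (W : X → Y → ℝ)
    (Q : X → ℝ) (R : ℝ) (L : ℕ) (V : X → Y → ℝ) : EReal :=
  condDiv V W Q + (((L : ℝ) * max 0 (inputChannelInfo Q V - R) : ℝ) : EReal)

/-- `D(V‖W|Q) + ρ (I(X;Y) - R)`. -/
noncomputable def rhoObjective {X Y : Type*} [Fintype X] [Fintype Y] (W : X → Y → ℝ)
    (Q : X → ℝ) (R ρ : ℝ) (V : X → Y → ℝ) : EReal :=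
  condDiv V W Q + ((ρ * (inputChannelInfo Q V - R) : ℝ) : EReal)

/-- The number of messages `M = e^{nR} + 1`, with `e^{nR}` rounded down to an integer. -/
noncomputable def numMessages (R : ℝ) (n : ℕ) : ℕ :=
  ⌊Real.exp (n * R)⌋₊ + 1

/-- A list decoder knows the codebook and maps each channel output to a set of messages. -/
abbrev ListDecoder (X Y : Type*) (n M : ℕ) :=
  (Fin M → Fin n → X) → (Fin n → Y) → Finset (Fin M)

/-- Every list consists of exactly `L` messages. -/
def HasListSize {X Y : Type*} {n M : ℕ} (L : ℕ) (g : ListDecoder X Y n M) : Prop :=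
  ∀ C y, (g C y).card = L

/-- The list `s` holds messages of highest score: no message outside it beats one inside it
(ties may be resolved arbitrarily). -/
def IsTopList {M : ℕ} (score : Fin M → ℝ) (s : Finset (Fin M)) : Prop :=
  ∀ m ∈ s, ∀ m' ∉ s, score m' ≤ score m

/-- The maximum likelihood list decoder with list size `L`. -/
def IsMLListDecoder {X Y : Type*} {n M : ℕ} (W : X → Y → ℝ) (L : ℕ)
    (g : ListDecoder X Y n M) : Prop :=
  HasListSize L g ∧ ∀ C y, IsTopList (fun m => seqProb W (C m) y) (g C y)

/-- The maximum mutual information list decoder with list size `L`; it does not involve the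
channel. -/
def IsMMIListDecoder {X Y : Type*} [Fintype X] [Fintype Y] [DecidableEq X] [DecidableEq Y]
    {n M : ℕ} (L : ℕ) (g : ListDecoder X Y n M) : Prop :=
  HasListSize L g ∧ ∀ C y, IsTopList (fun m => empMutualInfo (C m) y) (g C y)

/-- The list-error probability of a given codebook with equiprobable messages: the probability
that the transmitted message is not in the list. -/
noncomputable def listErrorProb {X Y : Type*} [Fintype Y] {n M : ℕ} (W : X → Y → ℝ)
    (g : ListDecoder X Y n M) (C : Fin M → Fin n → X) : ℝ :=
  (1 / (M : ℝ)) * ∑ m, ∑ y, seqProb W (C m) y * (if m ∈ g C y then 0 else 1)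

/-- The average of the list-error probability over codebooks whose codewords are drawn
independently according to `P`. -/
noncomputable def avgListError {X Y : Type*} [Fintype X] [Fintype Y] {n M : ℕ}
    (W : X → Y → ℝ) (P : (Fin n → X) → ℝ) (g : ListDecoder X Y n M) : ℝ :=
  ∑ C : Fin M → Fin n → X, (∏ m, P (C m)) * listErrorProb W g C

/-- The Gallager / Viterbi-Omura bound
`min_{0 ≤ ρ ≤ L} M^ρ ∑_𝐲 [∑_𝐱 P(𝐱) W(𝐲|𝐱)^{1/(1+ρ)}]^{1+ρ}`. -/
noncomputable def gallagerBound {X Y : Type*} [Fintype X] [Fintype Y] {n : ℕ}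
    (W : X → Y → ℝ) (P : (Fin n → X) → ℝ) (M L : ℕ) : ℝ :=
  sInf ((fun ρ : ℝ => (M : ℝ) ^ ρ *
      ∑ y : Fin n → Y, (∑ x : Fin n → X, P x * seqProb W x y ^ (1 / (1 + ρ))) ^ (1 + ρ)) ''
    Set.Icc (0 : ℝ) L)

/-- Equality to exponential order `a ≐ b` along the block lengths `n k`: both sequences are
(eventually) positive and `(1/n) log (a/b) → 0`. -/
def ExpEq (n : ℕ → ℕ) (a b : ℕ → ℝ) : Prop :=
  (∀ᶠ k in atTop, 0 < a k) ∧ (∀ᶠ k in atTop, 0 < b k) ∧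
    Tendsto (fun k => 1 / (n k : ℝ) * Real.log (a k / b k)) atTop (𝓝 0)

end ListDecoding

/-! The proof is the method of types. Input, output and codeword averages split into sums over joint
types P with first marginal Q_n, of which there are only polynomially many. For such a P, the pair
(transmitted word, output) has type P with probability `typeMass` ≐ exp(-nD), and an independent
codeword has type P with a given output of the right type with probability `hitProb` ≐ exp(-nI).
Everything then reduces to showing that each type contributes exp(-nD) min(1, exp(n(R-I)))^L, that
is exp(-n(D + L[I-R]₊)).

Upper bound (`IsMMIListDecoder.avgListError_le`): if the MMI list misses the sent message, then L
other codewords have at least its empirical mutual information I. Given the sent word and the output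
these codewords are independent, and each reaches I with probability about exp(-nI), so a union
bound over L-subsets, truncated at one, gives the factor.

Lower bound for every decoder (`le_avgListError`): for a fixed output y, the number N of codewords
of joint type P with y is binomial. All of them have the same likelihood, and at least N - L of them
are off the list. The mean of (N-L)₊ is at least a constant times Mp min(1, Mp)^L, where p =
`hitProb` (`le_sum_prod_mul_surplus`). The two bounds agree type by type, so MMI is exponentially
optimal; ML, being optimal outright, lies between them.

In the Gallager expression the powers 1/(1+ρ) and 1+ρ cancel on the likelihood, and a type
contributes exp(-nD)(M p)^ρ up to polynomial factors. Since min(1,z)^L ≤ z^ρ for 0 ≤ ρ ≤ L, no ρ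
beats the exact exponent. That some ρ reaches it is a minimax statement: D + ρ(I-R) is convex in the
coupling, because the input marginal is fixed, and affine in ρ, so Sion's theorem yields a saddle
point (`exists_saddle`). The same saddle point gives the max-min formula.

Passing from Q_n to Q uses compactness of the set of channels (`eventually_forall_coupl_le`) and
rounding of couplings to joint types (`eventually_exists_jointType`). -/

namespace ListDecoding

/-! ### Counting sequences of a given type -/

section Types

variable {A : Type*}

/-- The Shannon entropy (in nats) of a finite distribution. -/
noncomputable def ent [Fintype A] (P : A → ℝ) : ℝ :=
  ∑ a, Real.negMulLog (P a)

/-- The subexponential slack appearing in bounds on the size of a type class. -/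
noncomputable def slack (n : ℕ) : ℝ :=
  1 + 2 * Real.log (n + 1)

lemma one_le_slack (n : ℕ) : 1 ≤ slack n := by
  have : 0 ≤ Real.log ((n : ℝ) + 1) := Real.log_nonneg (by linarith [n.cast_nonneg (α := ℝ)])
  unfold slack
  linarith

lemma slack_nonneg (n : ℕ) : 0 ≤ slack n := zero_le_one.trans (one_le_slack n)

lemma slack_mono {m n : ℕ} (h : m ≤ n) : slack m ≤ slack n := by
  have h' : (m : ℝ) ≤ n := by exact_mod_cast h
  have : Real.log ((m : ℝ) + 1) ≤ Real.log ((n : ℝ) + 1) :=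
    Real.log_le_log (by positivity) (by linarith)
  unfold slack
  linarith

/-- One term of the exponential series at k, namely k^k/k!, is at most e^k. -/
lemma mul_log_sub_le_log_factorial (k : ℕ) :
    k * Real.log k - k ≤ Real.log (k.factorial : ℝ) := by
  rcases Nat.eq_zero_or_pos k with rfl | hk
  · simp
  have hk' : (0 : ℝ) < k := by exact_mod_cast hk
  have hf : (0 : ℝ) < (k.factorial : ℝ) := by exact_mod_cast k.factorial_pos
  have h := Real.pow_div_factorial_le_exp (k : ℝ) hk'.le k
  have h2 := Real.log_le_log (by positivity) h
  rw [Real.log_exp, Real.log_div (by positivity) hf.ne', Real.log_pow] at h2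
  linarith

lemma log_factorial_le (k : ℕ) :
    Real.log (k.factorial : ℝ) ≤ k * Real.log k - k + slack k := by
  induction k with
  | zero => simp [slack]
  | succ k ih =>
    have hk : (0 : ℝ) ≤ k := k.cast_nonneg
    have hf : (0 : ℝ) < (k.factorial : ℝ) := by exact_mod_cast k.factorial_pos
    rw [Nat.factorial_succ, Nat.cast_mul, Real.log_mul (by positivity) hf.ne']
    -- The induction step amounts to 1 ≤ k(log(k+1) - log k) + 2(log(k+2) - log(k+1)), the last term
    -- being the growth of `slack`. Bounding each logarithm by 1 - 1/t leaves k/(k+1) + 2/(k+2) ≥ 1,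
    -- which is where the factor 2 in `slack` is used.
    have h1 : (k : ℝ) / (k + 1) ≤ k * (Real.log (k + 1) - Real.log k) := by
      rcases eq_or_lt_of_le hk with h0 | h0
      · simp [← h0]
      rw [← Real.log_div (by positivity) h0.ne', div_eq_mul_inv]
      refine mul_le_mul_of_nonneg_left ?_ hk
      have := Real.one_sub_inv_le_log_of_pos (x := ((k : ℝ) + 1) / k) (by positivity)
      refine le_trans (le_of_eq ?_) this
      field_simp
      ring
    have h2 : 1 / ((k : ℝ) + 2) ≤ Real.log (k + 2) - Real.log (k + 1) := by
      rw [← Real.log_div (by positivity) (by positivity)]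
      have := Real.one_sub_inv_le_log_of_pos (x := ((k : ℝ) + 2) / (k + 1)) (by positivity)
      refine le_trans (le_of_eq ?_) this
      field_simp
      ring
    have h3 : 1 ≤ (k : ℝ) / (k + 1) + 2 * (1 / ((k : ℝ) + 2)) := by
      rw [← sub_nonneg]
      have : (k : ℝ) / (k + 1) + 2 * (1 / ((k : ℝ) + 2)) - 1 = k / ((k + 1) * (k + 2)) := by
        field_simp
        ring
      rw [this]
      positivity
    unfold slack at *
    push_cast
    rw [show (k : ℝ) + 1 + 1 = k + 2 by ring]
    nlinarith

variable [DecidableEq A] {n : ℕ}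

/-- The number of occurrences of a letter in a sequence. -/
def cnt (x : Fin n → A) (a : A) : ℕ :=
  (Finset.univ.filter (fun i => x i = a)).card

lemma empDist_apply (x : Fin n → A) (a : A) : empDist x a = (cnt x a : ℝ) / n := rfl

lemma empDist_nonneg (x : Fin n → A) (a : A) : 0 ≤ empDist x a := by
  rw [empDist_apply]
  positivity

lemma cnt_le (x : Fin n → A) (a : A) : cnt x a ≤ n := by
  simpa [cnt] using Finset.card_filter_le Finset.univ (fun i => x i = a)

lemma mul_empDist (x : Fin n → A) (a : A) : (n : ℝ) * empDist x a = cnt x a := by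
  rcases Nat.eq_zero_or_pos n with rfl | hn
  · simp [cnt]
  · have : (n : ℝ) ≠ 0 := by positivity
    rw [empDist_apply]
    field_simp

lemma empDist_eq_iff {x x' : Fin n → A} : empDist x = empDist x' ↔ cnt x = cnt x' := by
  constructor
  · intro h
    ext a
    have := mul_empDist x a
    rw [h, mul_empDist] at this
    exact_mod_cast this.symm
  · intro h
    ext a
    rw [empDist_apply, empDist_apply, h]

lemma cnt_comp_perm (x : Fin n → A) (σ : Equiv.Perm (Fin n)) : cnt (x ∘ σ) = cnt x := by
  ext a
  unfold cnt
  refine Finset.card_bij (fun i _ => σ i) ?_ ?_ ?_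
  · intro i hi
    simpa using hi
  · intro i _ j _ h
    exact σ.injective h
  · intro j hj
    exact ⟨σ.symm j, by simpa using hj, by simp⟩

lemma empDist_comp_perm (x : Fin n → A) (σ : Equiv.Perm (Fin n)) :
    empDist (x ∘ σ) = empDist x :=
  empDist_eq_iff.2 (cnt_comp_perm x σ)

/-- The fibres of the two sequences over each letter have equal size; bijections between them glue
to a permutation of positions. -/
lemma exists_perm_of_cnt_eq {x x' : Fin n → A} (h : cnt x = cnt x') :
    ∃ σ : Equiv.Perm (Fin n), x ∘ σ = x' := by
  have h' : ∀ a, Nonempty ({i // x' i = a} ≃ {i // x i = a}) := by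
    intro a
    refine ⟨Fintype.equivOfCardEq ?_⟩
    rw [Fintype.card_subtype, Fintype.card_subtype]
    exact (congrFun h a).symm
  let e := fun a => (h' a).some
  refine ⟨(Equiv.sigmaFiberEquiv x').symm.trans
    ((Equiv.sigmaCongrRight e).trans (Equiv.sigmaFiberEquiv x)), ?_⟩
  ext i
  exact (e (x' i) ⟨i, rfl⟩).2

variable [Fintype A]

lemma mem_typeClass {Q : A → ℝ} {x : Fin n → A} : x ∈ typeClass n Q ↔ empDist x = Q := by
  simp [typeClass]

lemma sum_cnt (x : Fin n → A) : ∑ a, cnt x a = n := by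
  have := Finset.card_eq_sum_card_fiberwise (f := x) (s := Finset.univ) (t := Finset.univ)
    (fun _ _ => Finset.mem_coe.2 (Finset.mem_univ _))
  simpa [cnt] using this.symm

lemma sum_empDist (hn : 0 < n) (x : Fin n → A) : ∑ a, empDist x a = 1 := by
  have hn' : (n : ℝ) ≠ 0 := by positivity
  simp_rw [empDist_apply]
  rw [← Finset.sum_div, ← Nat.cast_sum, sum_cnt, div_self hn']

lemma exists_cnt_eq (c : A → ℕ) (hc : ∑ a, c a = n) : ∃ x : Fin n → A, cnt x = c := by
  let e : Fin n ≃ Σ a, Fin (c a) := Fintype.equivOfCardEq (by simp [hc])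
  refine ⟨fun i => (e i).1, ?_⟩
  ext a
  unfold cnt
  rw [← Fintype.card_subtype]
  have e2 : {i // (e i).1 = a} ≃ {s : Σ a, Fin (c a) // s.1 = a} :=
    e.subtypeEquiv (fun i => Iff.rfl)
  rw [Fintype.card_congr (e2.trans (Equiv.sigmaSubtype (β := fun a => Fin (c a)) a)),
    Fintype.card_fin]

lemma prod_comp_eq_prod_pow_cnt (f : A → ℝ) (x : Fin n → A) :
    ∏ i, f (x i) = ∏ a, f a ^ cnt x a := by
  rw [← Finset.prod_fiberwise_of_maps_to (s := Finset.univ) (t := Finset.univ) (g := x)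
    (fun _ _ => Finset.mem_univ _)]
  refine Finset.prod_congr rfl fun a _ => ?_
  rw [Finset.prod_congr rfl (g := fun _ => f a), Finset.prod_const]
  · rfl
  · intro i hi
    rw [(Finset.mem_filter.1 hi).2]

/-- Orbit and stabilizer: permuting positions maps the symmetric group onto the type class, and the
fibre over x ∘ τ is the translate by τ of the stabilizer of x, whose order is the product of
factorials. -/
lemma card_typeClass_mul_prod_factorial (x : Fin n → A) :
    (typeClass n (empDist x)).card * ∏ a, (cnt x a).factorial = n.factorial := by
  have h1 := Finset.card_eq_sum_card_fiberwise (f := fun σ : Equiv.Perm (Fin n) => x ∘ σ)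
    (s := Finset.univ) (t := typeClass n (empDist x))
    (fun σ _ => Finset.mem_coe.2 (mem_typeClass.2 (empDist_comp_perm x σ)))
  rw [Finset.card_univ, Fintype.card_perm, Fintype.card_fin] at h1
  rw [h1, ← smul_eq_mul, ← Finset.sum_const]
  refine Finset.sum_congr rfl fun x' hx' => ?_
  obtain ⟨τ, rfl⟩ := exists_perm_of_cnt_eq (empDist_eq_iff.1 (mem_typeClass.1 hx').symm)
  have h2 := DomMulAct.stabilizer_card x
  rw [Fintype.card_subtype] at h2
  have h3 : ∏ a, (cnt x a).factorial = ∏ i, (Fintype.card {a // x a = i}).factorial := by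
    refine Finset.prod_congr rfl fun a _ => ?_
    rw [Fintype.card_subtype, cnt]
  rw [h3, ← h2]
  refine Finset.card_bij (fun σ _ => σ * τ) ?_ ?_ ?_
  · intro σ hσ
    simp only [Finset.mem_filter, Finset.mem_univ, true_and] at hσ ⊢
    rw [Equiv.Perm.coe_mul, ← Function.comp_assoc, hσ]
  · intro σ _ σ' _ h
    exact mul_right_cancel h
  · intro σ hσ
    refine ⟨σ * τ⁻¹, ?_, by simp⟩
    simp only [Finset.mem_filter, Finset.mem_univ, true_and] at hσ ⊢
    rw [Equiv.Perm.coe_mul, ← Function.comp_assoc, hσ, Function.comp_assoc, ← Equiv.Perm.coe_mul]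
    simp

lemma card_typeClass_pos (x : Fin n → A) : 0 < (typeClass n (empDist x)).card :=
  Finset.card_pos.2 ⟨x, mem_typeClass.2 rfl⟩

lemma mul_ent_empDist (hn : 0 < n) (x : Fin n → A) :
    n * ent (empDist x) = n * Real.log n - ∑ a, cnt x a * Real.log (cnt x a) := by
  have hn' : (n : ℝ) ≠ 0 := by positivity
  have h1 : ∀ a, (n : ℝ) * Real.negMulLog (empDist x a)
      = cnt x a * Real.log n - cnt x a * Real.log (cnt x a) := by
    intro a
    rw [empDist_apply, Real.negMulLog]
    rcases Nat.eq_zero_or_pos (cnt x a) with h0 | h0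
    · simp [h0]
    rw [Real.log_div (by positivity) hn']
    field_simp
    ring
  rw [ent, Finset.mul_sum, Finset.sum_congr rfl fun a _ => h1 a, Finset.sum_sub_distrib,
    ← Finset.sum_mul, ← Nat.cast_sum, sum_cnt]

lemma log_card_typeClass (x : Fin n → A) :
    Real.log (typeClass n (empDist x)).card
      = Real.log n.factorial - ∑ a, Real.log (cnt x a).factorial := by
  have h := card_typeClass_mul_prod_factorial x
  have h2 : ((typeClass n (empDist x)).card : ℝ) * ∏ a, ((cnt x a).factorial : ℝ)
      = n.factorial := by exact_mod_cast h
  have hp : ∀ a ∈ (Finset.univ : Finset A), ((cnt x a).factorial : ℝ) ≠ 0 := fun a _ => by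
    exact_mod_cast (cnt x a).factorial_ne_zero
  rw [← h2, Real.log_mul (by exact_mod_cast (card_typeClass_pos x).ne')
    (Finset.prod_ne_zero_iff.2 hp), Real.log_prod hp]
  ring

/-- Lower bound on the size of a type class. -/
lemma le_log_card_typeClass (hn : 0 < n) (x : Fin n → A) :
    n * ent (empDist x) - Fintype.card A * slack n ≤
      Real.log (typeClass n (empDist x)).card := by
  rw [log_card_typeClass, mul_ent_empDist hn]
  have h1 := mul_log_sub_le_log_factorial n
  have h2 : ∑ a, Real.log (cnt x a).factorial
      ≤ ∑ a, (cnt x a * Real.log (cnt x a) - cnt x a + slack n) :=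
    Finset.sum_le_sum fun a _ => (log_factorial_le _).trans
      (by linarith [slack_mono (cnt_le x a)])
  rw [Finset.sum_add_distrib, Finset.sum_sub_distrib, ← Nat.cast_sum, sum_cnt, Finset.sum_const,
    nsmul_eq_mul, Finset.card_univ] at h2
  linarith

/-- Upper bound on the size of a type class. -/
lemma log_card_typeClass_le (hn : 0 < n) (x : Fin n → A) :
    Real.log (typeClass n (empDist x)).card ≤ n * ent (empDist x) := by
  have hn' : (0 : ℝ) < n := by positivity
  have hc : (0 : ℝ) < (typeClass n (empDist x)).card := by exact_mod_cast card_typeClass_pos x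
  have hpos : 0 < ∏ i, empDist x (x i) := by
    refine Finset.prod_pos fun i _ => ?_
    rw [empDist_apply]
    have : 0 < cnt x (x i) := Finset.card_pos.2 ⟨i, by simp⟩
    positivity
  -- Under the i.i.d. law with marginal `empDist x`, all members of the class are equally likely,
  -- and their total probability is at most one.
  have h1 : ((typeClass n (empDist x)).card : ℝ) * ∏ i, empDist x (x i) ≤ 1 := by
    calc ((typeClass n (empDist x)).card : ℝ) * ∏ i, empDist x (x i)
        = ∑ x' ∈ typeClass n (empDist x), ∏ i, empDist x (x' i) := by
          rw [← nsmul_eq_mul, ← Finset.sum_const]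
          refine Finset.sum_congr rfl fun x' hx' => ?_
          rw [prod_comp_eq_prod_pow_cnt, prod_comp_eq_prod_pow_cnt,
            empDist_eq_iff.1 (mem_typeClass.1 hx')]
      _ ≤ ∑ x' : Fin n → A, ∏ i, empDist x (x' i) :=
          Finset.sum_le_sum_of_subset_of_nonneg (Finset.subset_univ _)
            fun _ _ _ => Finset.prod_nonneg fun _ _ => empDist_nonneg _ _
      _ = 1 := by
          rw [← Fintype.piFinset_univ,
            ← Finset.prod_univ_sum (fun _ => Finset.univ) (fun (_ : Fin n) a => empDist x a)]
          simp [sum_empDist hn]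
  have h2 := Real.log_le_log (by positivity) h1
  rw [Real.log_mul hc.ne' hpos.ne', Real.log_one] at h2
  have h3 : Real.log (∏ i, empDist x (x i)) = - (n * ent (empDist x)) := by
    rw [prod_comp_eq_prod_pow_cnt, Real.log_prod, ent, Finset.mul_sum, ← Finset.sum_neg_distrib]
    · refine Finset.sum_congr rfl fun a _ => ?_
      rw [Real.log_pow, ← mul_empDist, Real.negMulLog]
      ring
    · intro a _ h0
      rw [prod_comp_eq_prod_pow_cnt] at hpos
      exact hpos.ne' (Finset.prod_eq_zero (Finset.mem_univ a) h0)
  linarith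

/-- The set of all types of sequences of length `n`. -/
noncomputable def types (n : ℕ) (A : Type*) [Fintype A] [DecidableEq A] : Finset (A → ℝ) :=
  haveI := Classical.decEq (A → ℝ)
  Finset.univ.image (fun x : Fin n → A => empDist x)

lemma mem_types {P : A → ℝ} : P ∈ types n A ↔ ∃ x : Fin n → A, empDist x = P := by
  simp [types]

lemma card_types_le : (types n A).card ≤ (n + 1) ^ Fintype.card A := by
  classical
  have : types n A ⊆ (Finset.univ : Finset (A → Fin (n + 1))).image
      (fun c a => ((c a : ℕ) : ℝ) / n) := by
    intro P hP
    obtain ⟨x, rfl⟩ := mem_types.1 hP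
    refine Finset.mem_image.2 ⟨fun a => ⟨cnt x a, Nat.lt_succ_of_le (cnt_le x a)⟩,
      Finset.mem_univ _, ?_⟩
    ext a
    rfl
  refine (Finset.card_le_card this).trans (Finset.card_image_le.trans ?_)
  simp

lemma card_types_le_exp :
    ((types n A).card : ℝ) ≤ Real.exp (Fintype.card A * slack n) := by
  have h1 : ((types n A).card : ℝ) ≤ ((n : ℝ) + 1) ^ Fintype.card A := by
    exact_mod_cast card_types_le (n := n) (A := A)
  refine h1.trans ?_
  rw [mul_comm, ← Real.rpow_natCast, Real.rpow_def_of_pos (by positivity)]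
  refine Real.exp_le_exp.2 (mul_le_mul_of_nonneg_right ?_ (Nat.cast_nonneg _))
  have : 0 ≤ Real.log ((n : ℝ) + 1) := Real.log_nonneg (by linarith [n.cast_nonneg (α := ℝ)])
  unfold slack
  linarith

end Types

/-! ### Joint types and the probabilities attached to them -/

section JointTypes

variable {X Y : Type*} [Fintype X] [Fintype Y]

/-- The first marginal of a joint distribution. -/
noncomputable def margX (P : X × Y → ℝ) : X → ℝ := fun x => ∑ y, P (x, y)

/-- The second marginal of a joint distribution. -/
noncomputable def margY (P : X × Y → ℝ) : Y → ℝ := fun y => ∑ x, P (x, y)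

/-- The mutual information in terms of entropies. -/
noncomputable def jointInfo (P : X × Y → ℝ) : ℝ := ent (margX P) + ent (margY P) - ent P

/-- The conditional divergence of a joint distribution `P` from the channel `W`; meaningful if
`P` vanishes where `W` does. -/
noncomputable def jointDiv (W : X → Y → ℝ) (P : X × Y → ℝ) : ℝ :=
  ent (margX P) - ent P - ∑ p : X × Y, P p * Real.log (W p.1 p.2)

/-- `P` vanishes wherever the channel `W` does. -/
def Compat (W : X → Y → ℝ) (P : X × Y → ℝ) : Prop := ∀ p : X × Y, W p.1 p.2 = 0 → P p = 0

/-- The value of `W(𝐲|𝐱)` for pairs of sequences of length `n` and joint type `P`. -/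
noncomputable def typeProb (W : X → Y → ℝ) (n : ℕ) (P : X × Y → ℝ) : ℝ :=
  open scoped Classical in
  if Compat W P then Real.exp (n * ∑ p : X × Y, P p * Real.log (W p.1 p.2)) else 0

variable [DecidableEq X] [DecidableEq Y] {n : ℕ}

/-- Two sequences combined to a sequence of pairs. -/
abbrev pairSeq (x : Fin n → X) (y : Fin n → Y) : Fin n → X × Y := fun i => (x i, y i)

/-- The sequences having joint type `P` with `y`. -/
noncomputable def condClass (P : X × Y → ℝ) (y : Fin n → Y) : Finset (Fin n → X) :=
  open scoped Classical in Finset.univ.filter fun x => empDist (pairSeq x y) = P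

/-- The probability that a sequence uniform over its type class has joint type `P` with a given
sequence of type `margY P`. -/
noncomputable def hitProb (n : ℕ) (P : X × Y → ℝ) : ℝ :=
  (typeClass n P).card / ((typeClass n (margX P)).card * (typeClass n (margY P)).card)

/-- The probability that the input and the output have joint type `P`. -/
noncomputable def typeMass (W : X → Y → ℝ) (n : ℕ) (P : X × Y → ℝ) : ℝ :=
  (typeClass n P).card * typeProb W n P / (typeClass n (margX P)).card

/-- Joint types with a given first marginal. -/
noncomputable def jointTypes (n : ℕ) (Q : X → ℝ) (Y : Type*) [Fintype Y] [DecidableEq Y] :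
    Finset (X × Y → ℝ) :=
  open scoped Classical in (types n (X × Y)).filter fun P => margX P = Q

omit [Fintype X] in
lemma margX_empDist (x : Fin n → X) (y : Fin n → Y) :
    margX (empDist (pairSeq x y)) = empDist x := by
  ext a
  simp_rw [margX, empDist_apply]
  rw [← Finset.sum_div, ← Nat.cast_sum]
  congr 2
  simp only [cnt]
  rw [Finset.card_eq_sum_card_fiberwise (f := y) (t := Finset.univ)
    (fun _ _ => Finset.mem_coe.2 (Finset.mem_univ _))]
  refine Finset.sum_congr rfl fun b _ => ?_
  rw [Finset.filter_filter]
  simp [pairSeq]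

omit [Fintype Y] in
lemma margY_empDist (x : Fin n → X) (y : Fin n → Y) :
    margY (empDist (pairSeq x y)) = empDist y := by
  ext b
  simp_rw [margY, empDist_apply]
  rw [← Finset.sum_div, ← Nat.cast_sum]
  congr 2
  simp only [cnt]
  rw [Finset.card_eq_sum_card_fiberwise (f := x) (t := Finset.univ)
    (fun _ _ => Finset.mem_coe.2 (Finset.mem_univ _))]
  refine Finset.sum_congr rfl fun a _ => ?_
  rw [Finset.filter_filter]
  simp [pairSeq, and_comm]

lemma mem_condClass {P : X × Y → ℝ} {x : Fin n → X} {y : Fin n → Y} :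
    x ∈ condClass P y ↔ empDist (pairSeq x y) = P := by
  simp [condClass]

lemma mem_jointTypes {Q : X → ℝ} {P : X × Y → ℝ} :
    P ∈ jointTypes n Q Y ↔ P ∈ types n (X × Y) ∧ margX P = Q := by
  simp [jointTypes]

lemma exists_pair_of_mem_types {P : X × Y → ℝ} (hP : P ∈ types n (X × Y)) :
    ∃ (x : Fin n → X) (y : Fin n → Y), empDist (pairSeq x y) = P := by
  obtain ⟨z, hz⟩ := mem_types.1 hP
  exact ⟨fun i => (z i).1, fun i => (z i).2, hz⟩

/-- Double counting by the second component: a permutation carrying y to another sequence of the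
same type matches their conditional classes, so all fibres have equal size. -/
lemma card_condClass_mul {P : X × Y → ℝ} {y : Fin n → Y} (hy : empDist y = margY P) :
    (condClass P y).card * (typeClass n (margY P)).card = (typeClass n P).card := by
  have h1 := Finset.card_eq_sum_card_fiberwise (f := fun z : Fin n → X × Y => fun i => (z i).2)
    (s := typeClass n P) (t := typeClass n (margY P)) (by
      intro z hz
      have hz' : empDist z = P := mem_typeClass.1 hz
      refine Finset.mem_coe.2 (mem_typeClass.2 ?_)
      rw [← hz']
      exact (margY_empDist (fun i => (z i).1) (fun i => (z i).2)).symm)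
  rw [h1, mul_comm, ← smul_eq_mul, ← Finset.sum_const]
  refine Finset.sum_congr rfl fun y' hy' => ?_
  obtain ⟨σ, rfl⟩ := exists_perm_of_cnt_eq
    (empDist_eq_iff.1 (hy.trans (mem_typeClass.1 hy').symm))
  refine Finset.card_bij (fun x _ => pairSeq (x ∘ σ) (y ∘ σ)) ?_ ?_ ?_
  · intro x hx
    refine Finset.mem_filter.2 ⟨mem_typeClass.2 ?_, rfl⟩
    rw [← mem_condClass.1 hx]
    exact empDist_comp_perm (pairSeq x y) σ
  · intro x _ x' _ h
    ext i
    have := congrFun h (σ.symm i)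
    simpa using congrArg Prod.fst this
  · intro z hz
    obtain ⟨hz1, hz2⟩ := Finset.mem_filter.1 hz
    have hz' : pairSeq (((fun i => (z i).1) ∘ σ.symm) ∘ σ) (y ∘ σ) = z := by
      ext i
      · simp
      · exact (congrFun hz2 i).symm
    refine ⟨(fun i => (z i).1) ∘ σ.symm, mem_condClass.2 ?_, hz'⟩
    rw [← empDist_comp_perm _ σ, ← mem_typeClass.1 hz1]
    exact congrArg empDist hz'

omit [DecidableEq X] [DecidableEq Y] in
lemma typeProb_nonneg (W : X → Y → ℝ) (P : X × Y → ℝ) : 0 ≤ typeProb W n P := by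
  unfold typeProb
  split_ifs
  · exact (Real.exp_pos _).le
  · exact le_rfl

lemma hitProb_nonneg (P : X × Y → ℝ) : 0 ≤ hitProb n P := by
  unfold hitProb
  positivity

lemma typeMass_nonneg (W : X → Y → ℝ) (P : X × Y → ℝ) : 0 ≤ typeMass W n P := by
  have := typeProb_nonneg (n := n) W P
  unfold typeMass
  positivity

/-- Likelihood depends on the pair only through its joint type. Where W vanishes, `Real.log` takes
the value 0; `Compat` makes this harmless, since such letter pairs then have count zero, and its
failure makes the product vanish. -/
lemma seqProb_eq_typeProb {W : X → Y → ℝ} (hW : IsChannel W) (x : Fin n → X) (y : Fin n → Y) :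
    seqProb W x y = typeProb W n (empDist (pairSeq x y)) := by
  have h1 : seqProb W x y = ∏ p : X × Y, W p.1 p.2 ^ cnt (pairSeq x y) p :=
    prod_comp_eq_prod_pow_cnt (fun p : X × Y => W p.1 p.2) (pairSeq x y)
  rw [h1, typeProb]
  split_ifs with hc
  · rw [Finset.mul_sum, Real.exp_sum]
    refine Finset.prod_congr rfl fun p _ => ?_
    rw [← mul_assoc, mul_empDist]
    rcases eq_or_lt_of_le ((hW p.1).1 p.2) with h0 | h0
    · have h2 := hc p h0.symm
      have h3 := mul_empDist (pairSeq x y) p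
      rw [h2, mul_zero] at h3
      have h4 : cnt (pairSeq x y) p = 0 := by exact_mod_cast h3.symm
      simp [h4]
    · rw [← Real.log_pow, Real.exp_log (by positivity)]
  · simp only [Compat, not_forall] at hc
    obtain ⟨p, hp, hp'⟩ := hc
    refine Finset.prod_eq_zero (Finset.mem_univ p) ?_
    rw [hp, zero_pow]
    intro h0
    exact hp' (by rw [empDist_apply, h0]; simp)

lemma card_condClass_div {P : X × Y → ℝ} (hP : P ∈ types n (X × Y)) {y : Fin n → Y}
    (hy : empDist y = margY P) :
    ((condClass P y).card : ℝ) / (typeClass n (margX P)).card = hitProb n P := by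
  obtain ⟨x0, y0, rfl⟩ := exists_pair_of_mem_types hP
  have h := card_condClass_mul hy
  have h1 : (0 : ℝ) < (typeClass n (margY (empDist (pairSeq x0 y0)))).card := by
    rw [margY_empDist]
    exact_mod_cast card_typeClass_pos y0
  rw [hitProb, ← h]
  push_cast
  rw [mul_div_mul_right _ _ h1.ne']

/-- Converts a per-output contribution, summed over the outputs of one type, into the probability
that input and output have joint type P. -/
lemma card_mul_hitProb_mul_typeProb {W : X → Y → ℝ} {P : X × Y → ℝ}
    (hP : P ∈ types n (X × Y)) :
    (typeClass n (margY P)).card * (hitProb n P * typeProb W n P) = typeMass W n P := by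
  obtain ⟨x0, y0, rfl⟩ := exists_pair_of_mem_types hP
  have h1 : (0 : ℝ) < (typeClass n (margY (empDist (pairSeq x0 y0)))).card := by
    rw [margY_empDist]
    exact_mod_cast card_typeClass_pos y0
  rw [hitProb, typeMass]
  field_simp

lemma uniformTypeClass_nonneg (Q : X → ℝ) (x : Fin n → X) : 0 ≤ uniformTypeClass n Q x := by
  unfold uniformTypeClass
  split_ifs <;> positivity

lemma sum_uniformTypeClass_mul (Q : X → ℝ) (f : (Fin n → X) → ℝ) :
    ∑ x, uniformTypeClass n Q x * f x
      = ∑ x ∈ typeClass n Q, 1 / ((typeClass n Q).card : ℝ) * f x := by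
  rw [← Finset.sum_subset (Finset.subset_univ (typeClass n Q))]
  · refine Finset.sum_congr rfl fun x hx => ?_
    rw [uniformTypeClass, if_pos hx]
  · intro x _ hx
    rw [uniformTypeClass, if_neg hx, zero_mul]

lemma sum_uniformTypeClass {Q : X → ℝ} (hQ : (typeClass n Q).Nonempty) :
    ∑ x, uniformTypeClass n Q x = 1 := by
  have h := sum_uniformTypeClass_mul (n := n) Q (fun _ => 1)
  have hc : ((typeClass n Q).card : ℝ) ≠ 0 := by exact_mod_cast (Finset.card_pos.2 hQ).ne'
  simp only [mul_one, Finset.sum_const, nsmul_eq_mul] at h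
  rw [h]
  field_simp

/-- Averages over the type class, sorted by the joint type with a given sequence. -/
lemma sum_uniformTypeClass_mul_empDist (Q : X → ℝ) (y : Fin n → Y) (f : (X × Y → ℝ) → ℝ) :
    ∑ x, uniformTypeClass n Q x * f (empDist (pairSeq x y)) =
      ∑ P ∈ jointTypes n Q Y, (if y ∈ typeClass n (margY P) then hitProb n P * f P else 0) := by
  classical
  rw [sum_uniformTypeClass_mul,
    ← Finset.sum_fiberwise_of_maps_to (s := typeClass n Q) (t := jointTypes n Q Y)
      (g := fun x => empDist (pairSeq x y))]
  · refine Finset.sum_congr rfl fun P hP => ?_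
    obtain ⟨hP1, hP2⟩ := mem_jointTypes.1 hP
    have h1 : (typeClass n Q).filter (fun x => empDist (pairSeq x y) = P) = condClass P y := by
      ext x
      rw [Finset.mem_filter, mem_condClass, mem_typeClass]
      refine ⟨fun h => h.2, fun h => ⟨?_, h⟩⟩
      rw [← hP2, ← h, margX_empDist]
    rw [h1, Finset.sum_congr rfl (g := fun _ => 1 / ((typeClass n Q).card : ℝ) * f P)]
    · rw [Finset.sum_const, nsmul_eq_mul]
      split_ifs with hy
      · rw [← card_condClass_div hP1 (mem_typeClass.1 hy), hP2]
        ring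
      · have : condClass P y = (∅ : Finset (Fin n → X)) := by
          refine Finset.eq_empty_of_forall_notMem fun x hx => hy ?_
          rw [mem_typeClass, ← mem_condClass.1 hx, margY_empDist]
        simp [this]
    · intro x hx
      rw [mem_condClass.1 hx]
  · intro x hx
    refine mem_jointTypes.2 ⟨mem_types.2 ⟨_, rfl⟩, ?_⟩
    rw [margX_empDist, mem_typeClass.1 hx]

omit [DecidableEq X] in
lemma sum_ite_mem_typeClass (P : X × Y → ℝ) (c : ℝ) :
    ∑ y : Fin n → Y, (if y ∈ typeClass n (margY P) then c else 0)
      = (typeClass n (margY P)).card * c := by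
  rw [← Finset.sum_filter, Finset.sum_const, nsmul_eq_mul]
  simp

/-- Averages over the input and the output, sorted by the joint type. -/
lemma sum_uniformTypeClass_mul_seqProb {W : X → Y → ℝ} (hW : IsChannel W) (Q : X → ℝ)
    (f : (X × Y → ℝ) → ℝ) :
    ∑ y : Fin n → Y, ∑ x, uniformTypeClass n Q x * (seqProb W x y * f (empDist (pairSeq x y))) =
      ∑ P ∈ jointTypes n Q Y, typeMass W n P * f P := by
  have h1 : ∀ y : Fin n → Y,
      ∑ x, uniformTypeClass n Q x * (seqProb W x y * f (empDist (pairSeq x y))) =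
      ∑ P ∈ jointTypes n Q Y,
        (if y ∈ typeClass n (margY P) then hitProb n P * (typeProb W n P * f P) else 0) := by
    intro y
    rw [← sum_uniformTypeClass_mul_empDist Q y (fun P => typeProb W n P * f P)]
    refine Finset.sum_congr rfl fun x _ => ?_
    rw [seqProb_eq_typeProb hW]
  rw [Finset.sum_congr rfl fun y _ => h1 y, Finset.sum_comm]
  refine Finset.sum_congr rfl fun P hP => ?_
  rw [sum_ite_mem_typeClass, ← card_mul_hitProb_mul_typeProb (mem_jointTypes.1 hP).1]
  ring

lemma typeMass_eq_zero {W : X → Y → ℝ} {P : X × Y → ℝ} (h : ¬ Compat W P) :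
    typeMass W n P = 0 := by
  simp [typeMass, typeProb, h]

/-! ### Exponents of the joint-type probabilities -/

section Bounds

variable {P : X × Y → ℝ}

lemma exp_mul_le_natCast {a : ℝ} {k : ℕ} (hk : 0 < k) (h : a ≤ Real.log k) :
    Real.exp a ≤ k := by
  have : (0 : ℝ) < k := by exact_mod_cast hk
  rw [← Real.exp_log this]
  exact Real.exp_le_exp.2 h

lemma natCast_le_exp {a : ℝ} {k : ℕ} (hk : 0 < k) (h : Real.log k ≤ a) :
    (k : ℝ) ≤ Real.exp a := by
  have : (0 : ℝ) < k := by exact_mod_cast hk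
  rw [← Real.exp_log this]
  exact Real.exp_le_exp.2 h

/-- Each type class has size exp(n · entropy) up to subexponential factors, and the three entropies
combine to the mutual information. -/
lemma le_hitProb (hn : 0 < n) (hP : P ∈ types n (X × Y)) :
    Real.exp (-(n * jointInfo P) - Fintype.card (X × Y) * slack n) ≤ hitProb n P := by
  obtain ⟨x, y, rfl⟩ := exists_pair_of_mem_types hP
  have h1 := exp_mul_le_natCast (card_typeClass_pos (pairSeq x y))
    (le_log_card_typeClass hn (pairSeq x y))
  have h2 := natCast_le_exp (card_typeClass_pos x) (log_card_typeClass_le hn x)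
  have h3 := natCast_le_exp (card_typeClass_pos y) (log_card_typeClass_le hn y)
  have h2' : (0 : ℝ) < (typeClass n (empDist x)).card := by exact_mod_cast card_typeClass_pos x
  have h3' : (0 : ℝ) < (typeClass n (empDist y)).card := by exact_mod_cast card_typeClass_pos y
  rw [hitProb, jointInfo, margX_empDist, margY_empDist, le_div_iff₀ (by positivity)]
  refine le_trans (mul_le_mul_of_nonneg_left
    (mul_le_mul h2 h3 h3'.le (Real.exp_pos _).le) (Real.exp_pos _).le) ?_
  rw [← Real.exp_add, ← Real.exp_add]
  refine le_trans (le_of_eq (congrArg _ ?_)) h1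
  ring

lemma hitProb_le (hn : 0 < n) (hP : P ∈ types n (X × Y)) :
    hitProb n P ≤
      Real.exp (-(n * jointInfo P) + (Fintype.card X + Fintype.card Y) * slack n) := by
  obtain ⟨x, y, rfl⟩ := exists_pair_of_mem_types hP
  have h1 := natCast_le_exp (card_typeClass_pos (pairSeq x y))
    (log_card_typeClass_le hn (pairSeq x y))
  have h2 := exp_mul_le_natCast (card_typeClass_pos x) (le_log_card_typeClass hn x)
  have h3 := exp_mul_le_natCast (card_typeClass_pos y) (le_log_card_typeClass hn y)
  have h2' : (0 : ℝ) < (typeClass n (empDist x)).card := by exact_mod_cast card_typeClass_pos x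
  have h3' : (0 : ℝ) < (typeClass n (empDist y)).card := by exact_mod_cast card_typeClass_pos y
  rw [hitProb, jointInfo, margX_empDist, margY_empDist, div_le_iff₀ (by positivity)]
  refine le_trans ?_ (mul_le_mul_of_nonneg_left
    (mul_le_mul h2 h3 (Real.exp_pos _).le h2'.le) (Real.exp_pos _).le)
  rw [← Real.exp_add, ← Real.exp_add]
  refine h1.trans (le_of_eq (congrArg _ ?_))
  ring

variable {W : X → Y → ℝ}

/-- The ratio of class sizes gives the conditional entropy of the output; together with the
log-likelihood it forms the conditional divergence. -/
lemma le_typeMass (hn : 0 < n) (hP : P ∈ types n (X × Y)) (hc : Compat W P) :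
    Real.exp (-(n * jointDiv W P) - Fintype.card (X × Y) * slack n) ≤ typeMass W n P := by
  obtain ⟨x, y, rfl⟩ := exists_pair_of_mem_types hP
  have h1 := exp_mul_le_natCast (card_typeClass_pos (pairSeq x y))
    (le_log_card_typeClass hn (pairSeq x y))
  have h2 := natCast_le_exp (card_typeClass_pos x) (log_card_typeClass_le hn x)
  have h2' : (0 : ℝ) < (typeClass n (empDist x)).card := by exact_mod_cast card_typeClass_pos x
  rw [typeMass, jointDiv, typeProb, if_pos hc, margX_empDist, le_div_iff₀ h2']
  refine le_trans (mul_le_mul_of_nonneg_left h2 (Real.exp_pos _).le) ?_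
  refine le_trans ?_ (mul_le_mul_of_nonneg_right h1 (Real.exp_pos _).le)
  rw [← Real.exp_add, ← Real.exp_add]
  refine le_of_eq (congrArg _ ?_)
  ring

lemma typeMass_le (hn : 0 < n) (hP : P ∈ types n (X × Y)) (hc : Compat W P) :
    typeMass W n P ≤ Real.exp (-(n * jointDiv W P) + Fintype.card X * slack n) := by
  obtain ⟨x, y, rfl⟩ := exists_pair_of_mem_types hP
  have h1 := natCast_le_exp (card_typeClass_pos (pairSeq x y))
    (log_card_typeClass_le hn (pairSeq x y))
  have h2 := exp_mul_le_natCast (card_typeClass_pos x) (le_log_card_typeClass hn x)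
  have h2' : (0 : ℝ) < (typeClass n (empDist x)).card := by exact_mod_cast card_typeClass_pos x
  rw [typeMass, jointDiv, typeProb, if_pos hc, margX_empDist, div_le_iff₀ h2']
  refine le_trans ?_ (mul_le_mul_of_nonneg_left h2 (Real.exp_pos _).le)
  refine le_trans (mul_le_mul_of_nonneg_right h1 (Real.exp_pos _).le) ?_
  rw [← Real.exp_add, ← Real.exp_add]
  refine le_of_eq (congrArg _ ?_)
  ring

end Bounds

end JointTypes

/-! ### Independent codewords: union bound and binomial surplus -/

section RandomCodebook

variable {α : Type*} [Fintype α] {M : ℕ}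

lemma sum_prod_eq_prod_sum (F : Fin M → α → ℝ) :
    ∑ C : Fin M → α, ∏ m, F m (C m) = ∏ m, ∑ a, F m a := by
  classical
  rw [← Fintype.piFinset_univ, ← Finset.prod_univ_sum (fun _ => Finset.univ) F]

variable {P : α → ℝ} (hP1 : ∑ a, P a = 1)

include hP1

lemma sum_prod_eq_one : ∑ C : Fin M → α, ∏ m, P (C m) = 1 := by
  rw [sum_prod_eq_prod_sum (fun _ => P)]
  simp [hP1]

/-- Independence in the form needed for the union bound: after fixing codeword m, the codewords
indexed by S, which avoids m, contribute independent identical factors. -/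
lemma sum_prod_mul_prod_mem [DecidableEq α] (m : Fin M) (a : α) (S : Finset (Fin M)) (hm : m ∉ S)
    (r : α → ℝ) :
    ∑ C : Fin M → α, (∏ i, P (C i)) * ((if C m = a then 1 else 0) * ∏ i ∈ S, r (C i)) =
      P a * (∑ b, P b * r b) ^ S.card := by
  have h1 : ∀ C : Fin M → α,
      (∏ i, P (C i)) * ((if C m = a then 1 else 0) * ∏ i ∈ S, r (C i)) =
      ∏ i, (fun i c => P c * ((if i = m then (if c = a then 1 else 0) else 1) *
        (if i ∈ S then r c else 1))) i (C i) := by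
    intro C
    simp only [Finset.prod_mul_distrib]
    congr 1
    congr 1
    · simp
    · simp [Finset.prod_ite_mem]
  rw [Finset.sum_congr rfl fun C _ => h1 C, sum_prod_eq_prod_sum (fun i c => P c *
    ((if i = m then (if c = a then 1 else 0) else 1) * (if i ∈ S then r c else 1)))]
  have h2 : ∀ i, ∑ c, P c * ((if i = m then (if c = a then 1 else 0) else 1) *
        (if i ∈ S then r c else 1)) =
      (if i = m then P a else 1) * (if i ∈ S then ∑ b, P b * r b else 1) := by
    intro i
    by_cases hi : i = m
    · subst hi
      simp [hm]
    · by_cases hS : i ∈ S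
      · simp [hi, hS]
      · simp [hi, hS, hP1]
  rw [Finset.prod_congr rfl fun i _ => h2 i, Finset.prod_mul_distrib]
  simp [Finset.prod_ite_mem]

lemma sum_prod_mul_apply [DecidableEq α] (m : Fin M) (f : α → ℝ) :
    ∑ C : Fin M → α, (∏ i, P (C i)) * f (C m) = ∑ a, P a * f a := by
  have h1 : ∀ C : Fin M → α, (∏ i, P (C i)) * f (C m) =
      ∑ a, f a * ((∏ i, P (C i)) * ((if C m = a then 1 else 0) *
        ∏ i ∈ (∅ : Finset (Fin M)), (1 : ℝ))) := by
    intro C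
    simp [mul_comm]
  rw [Finset.sum_congr rfl fun C _ => h1 C, Finset.sum_comm]
  refine Finset.sum_congr rfl fun a _ => ?_
  rw [← Finset.mul_sum]
  have := sum_prod_mul_prod_mem hP1 m a ∅ (by simp) (fun _ => 1)
  rw [this]
  simp [mul_comm]

variable (hP0 : ∀ a, 0 ≤ P a)

include hP0

/-- The union bound over `L`-subsets of the other messages, truncated at one. -/
lemma sum_prod_mul_le_min [DecidableEq α] {L : ℕ} (m : Fin M) {f : α → ℝ} (hf : ∀ a, 0 ≤ f a)
    {e : (Fin M → α) → ℝ} {r : α → α → ℝ} (hr : ∀ a b, 0 ≤ r a b) (he1 : ∀ C, e C ≤ 1)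
    (he2 : ∀ C, e C ≤ ∑ S ∈ (Finset.univ.erase m).powersetCard L, ∏ i ∈ S, r (C m) (C i)) :
    ∑ C : Fin M → α, (∏ i, P (C i)) * (f (C m) * e C) ≤
      ∑ a, P a * (f a * (min 1 (M * ∑ b, P b * r a b)) ^ L) := by
  have h1 : ∀ C : Fin M → α, (∏ i, P (C i)) * (f (C m) * e C) =
      ∑ a, f a * ((∏ i, P (C i)) * ((if C m = a then 1 else 0) * e C)) := by
    intro C
    rw [Finset.sum_eq_single (C m)]
    · simp only [if_true]
      ring
    · intro a _ ha
      rw [if_neg ha.symm]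
      simp
    · simp
  rw [Finset.sum_congr rfl fun C _ => h1 C, Finset.sum_comm]
  refine Finset.sum_le_sum fun a _ => ?_
  rw [← Finset.mul_sum, mul_left_comm (P a)]
  refine mul_le_mul_of_nonneg_left ?_ (hf a)
  have hPC : ∀ C : Fin M → α, 0 ≤ ∏ i, P (C i) := fun C => Finset.prod_nonneg fun i _ => hP0 _
  have hq : 0 ≤ ∑ b, P b * r a b := Finset.sum_nonneg fun b _ => mul_nonneg (hP0 b) (hr a b)
  -- When Mq ≥ 1 the trivial bound e ≤ 1 suffices. Otherwise the union bound has (M-1 choose L) ≤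
  -- M^L terms, each contributing q^L.
  rcases le_total (1 : ℝ) (M * ∑ b, P b * r a b) with h | h
  · rw [min_eq_left h, one_pow]
    have h2 := sum_prod_mul_prod_mem hP1 m a ∅ (by simp) (fun _ => 1)
    simp only [Finset.prod_empty, Finset.card_empty, pow_zero] at h2
    rw [← h2]
    refine Finset.sum_le_sum fun C _ => mul_le_mul_of_nonneg_left ?_ (hPC C)
    exact mul_le_mul_of_nonneg_left (he1 C) (by split_ifs <;> norm_num)
  · rw [min_eq_right h]
    have h2 : ∀ C : Fin M → α, (∏ i, P (C i)) * ((if C m = a then 1 else 0) * e C) ≤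
        ∑ S ∈ (Finset.univ.erase m).powersetCard L,
          (∏ i, P (C i)) * ((if C m = a then 1 else 0) * ∏ i ∈ S, r a (C i)) := by
      intro C
      rw [← Finset.mul_sum, ← Finset.mul_sum]
      refine mul_le_mul_of_nonneg_left ?_ (hPC C)
      split_ifs with hC
      · have := he2 C
        rw [hC] at this
        linarith
      · simp
    refine (Finset.sum_le_sum fun C _ => h2 C).trans ?_
    rw [Finset.sum_comm]
    have h3 : ∀ S ∈ ((Finset.univ : Finset (Fin M)).erase m).powersetCard L,
        ∑ C : Fin M → α, (∏ i, P (C i)) * ((if C m = a then 1 else 0) * ∏ i ∈ S, r a (C i)) =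
        P a * (∑ b, P b * r a b) ^ L := by
      intro S hS
      obtain ⟨hS1, hS2⟩ := Finset.mem_powersetCard.1 hS
      rw [sum_prod_mul_prod_mem hP1 m a S (fun h => Finset.notMem_erase m _ (hS1 h)), hS2]
    rw [Finset.sum_congr rfl h3, Finset.sum_const, nsmul_eq_mul, mul_left_comm, mul_pow]
    refine mul_le_mul_of_nonneg_left (mul_le_mul_of_nonneg_right ?_ (pow_nonneg hq L)) (hP0 a)
    rw [Finset.card_powersetCard, Finset.card_erase_of_mem (Finset.mem_univ _), Finset.card_univ,
      Fintype.card_fin]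
    calc (((M - 1).choose L : ℕ) : ℝ) ≤ ((M - 1 : ℕ) : ℝ) ^ L := by
          exact_mod_cast Nat.choose_le_pow (M - 1) L
      _ ≤ (M : ℝ) ^ L := by
          refine pow_le_pow_left₀ (Nat.cast_nonneg _) ?_ L
          exact_mod_cast Nat.sub_le M 1

omit hP0 in
lemma sum_prod_mul_card_filter [DecidableEq α] (A : Finset α) :
    ∑ C : Fin M → α, (∏ i, P (C i)) * ((Finset.univ.filter fun m => C m ∈ A).card : ℝ) =
      M * ∑ a ∈ A, P a := by
  have h1 : ∀ C : Fin M → α, (∏ i, P (C i)) * ((Finset.univ.filter fun m => C m ∈ A).card : ℝ) =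
      ∑ m, (∏ i, P (C i)) * (fun a => if a ∈ A then (1 : ℝ) else 0) (C m) := by
    intro C
    rw [← Finset.mul_sum]
    simp
  rw [Finset.sum_congr rfl fun C _ => h1 C, Finset.sum_comm,
    Finset.sum_congr rfl fun m _ =>
      sum_prod_mul_apply hP1 m (fun a => if a ∈ A then (1 : ℝ) else 0)]
  simp

-- The exact law of the set of indices hitting A; summing over S of size L + 1 later isolates the
-- event of exactly L + 1 hits.
omit hP0 in
lemma sum_prod_mul_filter_eq [DecidableEq α] (A : Finset α) (S : Finset (Fin M)) :
    ∑ C : Fin M → α,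
      (∏ i, P (C i)) * (if (Finset.univ.filter fun m => C m ∈ A) = S then (1 : ℝ) else 0) =
      (∑ a ∈ A, P a) ^ S.card * (1 - ∑ a ∈ A, P a) ^ (M - S.card) := by
  have h1 : ∀ C : Fin M → α,
      (∏ i, P (C i)) * (if (Finset.univ.filter fun m => C m ∈ A) = S then (1 : ℝ) else 0) =
      ∏ i, (fun i c => P c * (if i ∈ S then (if c ∈ A then 1 else 0)
        else (1 - if c ∈ A then 1 else 0))) i (C i) := by
    intro C
    simp only [Finset.prod_mul_distrib]
    congr 1
    split_ifs with h
    · symm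
      refine Finset.prod_eq_one fun i _ => ?_
      rw [← h]
      by_cases hi : C i ∈ A <;> simp [hi]
    · symm
      rw [Finset.ext_iff] at h
      push Not at h
      obtain ⟨i, hi⟩ := h
      refine Finset.prod_eq_zero (Finset.mem_univ i) ?_
      simp only [Finset.mem_filter, Finset.mem_univ, true_and] at hi
      rcases hi with ⟨h1, h2⟩ | ⟨h1, h2⟩ <;> simp [h1, h2]
  rw [Finset.sum_congr rfl fun C _ => h1 C, sum_prod_eq_prod_sum (fun i c => P c *
    (if i ∈ S then (if c ∈ A then 1 else 0) else (1 - if c ∈ A then 1 else 0)))]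
  have h2 : ∀ i, ∑ c, P c * (if i ∈ S then (if c ∈ A then 1 else 0)
        else (1 - if c ∈ A then 1 else 0)) =
      if i ∈ S then ∑ a ∈ A, P a else 1 - ∑ a ∈ A, P a := by
    intro i
    split_ifs with hi
    · simp
    · simp [mul_sub, hP1]
  rw [Finset.prod_congr rfl fun i _ => h2 i, Finset.prod_ite]
  simp only [Finset.prod_const]
  congr 2
  · simp
  · rw [Finset.filter_not, Finset.card_sdiff]
    simp

/-- The constant in the lower bound on the mean surplus over `L` of a binomial variable. -/
noncomputable def surplusConst (L : ℕ) : ℝ :=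
  1 / ((2 * ((L : ℝ) + 1)) ^ (L + 1) * 16 ^ L)

omit hP1 hP0 in
lemma surplusConst_pos (L : ℕ) : 0 < surplusConst L := by
  unfold surplusConst
  positivity

omit hP1 hP0 in
lemma surplusConst_le_half (L : ℕ) : surplusConst L ≤ 1 / 2 := by
  unfold surplusConst
  have h0 : (0 : ℝ) ≤ L := L.cast_nonneg
  have h1 : 2 * ((L : ℝ) + 1) ≤ (2 * ((L : ℝ) + 1)) ^ (L + 1) :=
    le_self_pow₀ (by linarith) (by omega)
  have h2 : (1 : ℝ) ≤ (16 : ℝ) ^ L := one_le_pow₀ (by norm_num)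
  refine one_div_le_one_div_of_le (by norm_num) ?_
  nlinarith

-- From (M-L)^(L+1)/(L+1)!, with M - L ≥ M/2 and (L+1)! ≤ (L+1)^(L+1). This supplies the first
-- factor of `surplusConst`.
omit hP1 hP0 in
lemma div_pow_le_choose {L M : ℕ} (hL : 1 ≤ L) (hM : 4 * L ≤ M) :
    ((M : ℝ) / (2 * (L + 1))) ^ (L + 1) ≤ (M.choose (L + 1) : ℝ) := by
  have h1 := Nat.pow_le_choose (α := ℝ) (L + 1) M
  refine le_trans ?_ h1
  rw [← div_div, div_pow]
  have h2 : (((L + 1).factorial : ℕ) : ℝ) ≤ ((L : ℝ) + 1) ^ (L + 1) := by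
    exact_mod_cast Nat.factorial_le_pow (L + 1)
  have h3 : (0 : ℝ) < (L + 1).factorial := by exact_mod_cast (L + 1).factorial_pos
  have h4 : (M : ℝ) / 2 ≤ ((M + 1 - (L + 1) : ℕ) : ℝ) := by
    rw [Nat.add_sub_add_right, Nat.cast_sub (by omega)]
    have : (4 : ℝ) * L ≤ M := by exact_mod_cast hM
    linarith [L.cast_nonneg (α := ℝ)]
  exact div_le_div₀ (by positivity) (pow_le_pow_left₀ (by positivity) h4 _) h3 h2

-- The chord of the convex function exp over [-log 2, 0], scaled by 2p, gives 4^(-p) ≤ 1 - p for p ≤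
-- 1/2. Raising to the power M and using Mp ≤ 2L yields 4^(-2L), the second factor of
-- `surplusConst`.
omit hP1 hP0 in
lemma inv_four_pow_le_one_sub_pow {p : ℝ} (hp0 : 0 ≤ p) (hp : p ≤ 1 / 2) {L M : ℕ}
    (h : M * p ≤ 2 * L) : 1 / 16 ^ L ≤ (1 - p) ^ M := by
  have h1 : Real.exp (-(p * Real.log 4)) ≤ 1 - p := by
    have hc := convexOn_exp.2 (Set.mem_univ (0 : ℝ)) (Set.mem_univ (-Real.log 2))
      (show 0 ≤ 1 - 2 * p by linarith) (show 0 ≤ 2 * p by linarith) (by ring)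
    simp only [smul_eq_mul, mul_zero, zero_add, Real.exp_zero, Real.exp_neg,
      Real.exp_log (show (0 : ℝ) < 2 by norm_num)] at hc
    have h4 : Real.log 4 = 2 * Real.log 2 := by
      rw [show (4 : ℝ) = 2 ^ 2 by norm_num, Real.log_pow]
      norm_num
    rw [h4, show -(p * (2 * Real.log 2)) = 2 * p * -Real.log 2 by ring]
    linarith
  have h2 : Real.exp (-(p * Real.log 4)) ^ M ≤ (1 - p) ^ M :=
    pow_le_pow_left₀ (Real.exp_pos _).le h1 M
  refine le_trans ?_ h2
  rw [← Real.exp_nat_mul]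
  have h3 : (1 : ℝ) / 16 ^ L = Real.exp (-(2 * L * Real.log 4)) := by
    rw [Real.exp_neg, show (2 : ℝ) * L * Real.log 4 = L * (2 * Real.log 4) by ring,
      Real.exp_nat_mul, show (2 : ℝ) * Real.log 4 = Real.log 16 by
        rw [show (16 : ℝ) = 4 ^ 2 by norm_num, Real.log_pow]; norm_num,
      Real.exp_log (by norm_num), one_div]
  rw [h3]
  refine Real.exp_le_exp.2 ?_
  have : 0 ≤ Real.log 4 := Real.log_nonneg (by norm_num)
  nlinarith

/-- Lower bound on the mean surplus over `L` of the number of codewords in a set. -/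
lemma le_sum_prod_mul_surplus [DecidableEq α] {L : ℕ} (hL : 1 ≤ L) (hM : 4 * L ≤ M)
    (A : Finset α) :
    surplusConst L * (M * ∑ a ∈ A, P a) * (min 1 (M * ∑ a ∈ A, P a)) ^ L ≤
      ∑ C : Fin M → α, (∏ i, P (C i)) *
        max (((Finset.univ.filter fun m => C m ∈ A).card : ℝ) - L) 0 := by
  have hPC : ∀ C : Fin M → α, 0 ≤ ∏ i, P (C i) := fun C => Finset.prod_nonneg fun i _ => hP0 _
  set p := ∑ a ∈ A, P a with hp
  have hp0 : 0 ≤ p := Finset.sum_nonneg fun a _ => hP0 a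
  have hMR : (4 : ℝ) * L ≤ M := by exact_mod_cast hM
  have hLR : (1 : ℝ) ≤ L := by exact_mod_cast hL
  have hc := surplusConst_pos L
  have hmin0 : 0 ≤ min 1 (M * p) := le_min zero_le_one (by positivity)
  -- For Mp ≥ 2L the mean alone suffices: Mp - L ≥ Mp/2. For Mp ≤ 2L only the event of exactly L + 1
  -- hits, with surplus 1, is kept; there M ≥ 4L forces p ≤ 1/2.
  rcases le_total (2 * (L : ℝ)) (M * p) with h | h
  · have h1 : ∑ C : Fin M → α, (∏ i, P (C i)) *
        (((Finset.univ.filter fun m => C m ∈ A).card : ℝ) - L) = M * p - L := by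
      simp only [mul_sub, Finset.sum_sub_distrib]
      rw [sum_prod_mul_card_filter hP1, ← Finset.sum_mul, sum_prod_eq_one hP1, one_mul]
    have h2 : (min 1 ((M : ℝ) * p)) ^ L ≤ 1 := pow_le_one₀ hmin0 (min_le_left _ _)
    calc surplusConst L * (M * p) * (min 1 (M * p)) ^ L
        ≤ surplusConst L * (M * p) * 1 := mul_le_mul_of_nonneg_left h2 (by positivity)
      _ ≤ 1 / 2 * (M * p) * 1 := by
          have := surplusConst_le_half L
          have : (0 : ℝ) ≤ M * p := by positivity
          nlinarith
      _ ≤ M * p - L := by linarith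
      _ ≤ _ := by
          rw [← h1]
          exact Finset.sum_le_sum fun C _ => mul_le_mul_of_nonneg_left (le_max_left _ _) (hPC C)
  · have hM0 : (0 : ℝ) < M := by linarith
    have hp2 : p ≤ 1 / 2 := by
      by_contra hcon
      push Not at hcon
      nlinarith
    have h1 : ∀ C : Fin M → α,
        ∑ S ∈ (Finset.univ : Finset (Fin M)).powersetCard (L + 1), (∏ i, P (C i)) *
          (if (Finset.univ.filter fun m => C m ∈ A) = S then (1 : ℝ) else 0) ≤
        (∏ i, P (C i)) * max (((Finset.univ.filter fun m => C m ∈ A).card : ℝ) - L) 0 := by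
      intro C
      rw [← Finset.mul_sum]
      refine mul_le_mul_of_nonneg_left ?_ (hPC C)
      rw [Finset.sum_ite_eq]
      split_ifs with hS
      · rw [(Finset.mem_powersetCard.1 hS).2]
        refine le_max_of_le_left ?_
        push_cast
        linarith
      · exact le_max_right _ _
    refine le_trans ?_ (Finset.sum_le_sum fun C _ => h1 C)
    rw [Finset.sum_comm, Finset.sum_congr rfl fun S _ => sum_prod_mul_filter_eq hP1 A S, ← hp]
    have h2 : ∀ S ∈ (Finset.univ : Finset (Fin M)).powersetCard (L + 1),
        p ^ (L + 1) * (1 / 16 ^ L) ≤ p ^ S.card * (1 - p) ^ (M - S.card) := by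
      intro S hS
      rw [(Finset.mem_powersetCard.1 hS).2]
      refine mul_le_mul_of_nonneg_left ?_ (by positivity)
      refine (inv_four_pow_le_one_sub_pow hp0 hp2 h).trans ?_
      exact pow_le_pow_of_le_one (by linarith) (by linarith) (Nat.sub_le _ _)
    refine le_trans ?_ (Finset.sum_le_sum h2)
    rw [Finset.sum_const, nsmul_eq_mul, Finset.card_powersetCard, Finset.card_univ,
      Fintype.card_fin]
    calc surplusConst L * (M * p) * (min 1 (M * p)) ^ L
        ≤ surplusConst L * (M * p) * (M * p) ^ L :=
          mul_le_mul_of_nonneg_left (pow_le_pow_left₀ hmin0 (min_le_right _ _) L) (by positivity)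
      _ = ((M : ℝ) / (2 * (L + 1))) ^ (L + 1) * (p ^ (L + 1) * (1 / 16 ^ L)) := by
          unfold surplusConst
          rw [div_pow, pow_succ (M : ℝ), pow_succ p, mul_pow (M : ℝ) p]
          field_simp
      _ ≤ _ := mul_le_mul_of_nonneg_right (div_pow_le_choose hL hM) (by positivity)

end RandomCodebook

/-! ### Lists of highest score -/

section Lists

/-- An L-subset of largest total score works: otherwise swapping one member for a better outsider
would raise the total. -/
lemma exists_isTopList {M L : ℕ} (hLM : L ≤ M) (score : Fin M → ℝ) :
    ∃ s : Finset (Fin M), s.card = L ∧ IsTopList score s := by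
  obtain ⟨s, hs, hmax⟩ := Finset.exists_max_image
    ((Finset.univ : Finset (Fin M)).powersetCard L) (fun s => ∑ m ∈ s, score m)
    (Finset.powersetCard_nonempty.2 (by simpa using hLM))
  have hcard := (Finset.mem_powersetCard.1 hs).2
  refine ⟨s, hcard, fun m hm m' hm' => ?_⟩
  have hm'' : m' ∉ s.erase m := fun h => hm' (Finset.mem_of_mem_erase h)
  have h := hmax (insert m' (s.erase m)) (Finset.mem_powersetCard.2 ⟨Finset.subset_univ _, by
    rw [Finset.card_insert_of_notMem hm'', Finset.card_erase_of_mem hm, hcard]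
    have : 0 < s.card := Finset.card_pos.2 ⟨m, hm⟩
    omega⟩)
  rw [Finset.sum_insert hm'', ← Finset.add_sum_erase s score hm] at h
  linarith

/-- The differences s \ t and t \ s have equal size, and every score in the latter is at most the
smallest score in the former. With likelihoods as scores this is the optimality of ML. -/
lemma IsTopList.sum_le {M : ℕ} {score : Fin M → ℝ} {s t : Finset (Fin M)}
    (hs : IsTopList score s) (hcard : t.card = s.card) :
    ∑ m ∈ t, score m ≤ ∑ m ∈ s, score m := by
  rw [← Finset.sum_inter_add_sum_sdiff t s, ← Finset.sum_inter_add_sum_sdiff s t,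
    Finset.inter_comm t s]
  refine add_le_add le_rfl ?_
  have hc : (t \ s).card = (s \ t).card := Finset.card_sdiff_comm hcard
  rcases (s \ t).eq_empty_or_nonempty with h0 | h0
  · have h1 : t \ s = ∅ := Finset.card_eq_zero.1 (by rw [hc, h0, Finset.card_empty])
    rw [h0, h1]
  · obtain ⟨m0, hm0, hmin⟩ := Finset.exists_min_image (s \ t) score h0
    calc ∑ m ∈ t \ s, score m ≤ (t \ s).card • score m0 :=
          Finset.sum_le_card_nsmul _ _ _ fun m hm =>
            hs m0 (Finset.mem_sdiff.1 hm0).1 m (Finset.mem_sdiff.1 hm).2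
      _ = (s \ t).card • score m0 := by rw [hc]
      _ ≤ ∑ m ∈ s \ t, score m := Finset.card_nsmul_le_sum _ _ _ hmin

end Lists

/-! ### Non-asymptotic bounds for decoders and for the Gallager expression -/

section Decoders

variable {X Y : Type*} [Fintype X] [Fintype Y] {n M L : ℕ} {W : X → Y → ℝ}

omit [Fintype X] in
lemma seqProb_nonneg (hW : IsChannel W) (x : Fin n → X) (y : Fin n → Y) : 0 ≤ seqProb W x y :=
  Finset.prod_nonneg fun i _ => (hW (x i)).1 (y i)

/-- The output is moved outermost, so that decoders can be analysed separately for each received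
sequence. -/
lemma avgListError_eq (P : (Fin n → X) → ℝ) (g : ListDecoder X Y n M) :
    avgListError W P g = 1 / (M : ℝ) * ∑ y, ∑ C : Fin M → Fin n → X, (∏ m, P (C m)) *
      ∑ m, seqProb W (C m) y * (if m ∈ g C y then 0 else 1) := by
  unfold avgListError listErrorProb
  rw [Finset.sum_comm, Finset.mul_sum]
  refine Finset.sum_congr rfl fun C _ => ?_
  rw [mul_left_comm, ← Finset.mul_sum, Finset.sum_comm]

/-- A maximum likelihood decoder is optimal among all decoders of the same list size. -/
lemma IsMLListDecoder.avgListError_le {g g' : ListDecoder X Y n M} (hg : IsMLListDecoder W L g)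
    (hg' : HasListSize L g') {P : (Fin n → X) → ℝ} (hP : ∀ x, 0 ≤ P x) :
    avgListError W P g ≤ avgListError W P g' := by
  rw [avgListError_eq, avgListError_eq]
  refine mul_le_mul_of_nonneg_left (Finset.sum_le_sum fun y _ => Finset.sum_le_sum fun C _ =>
    mul_le_mul_of_nonneg_left ?_ (Finset.prod_nonneg fun m _ => hP _)) (by positivity)
  have h := (hg.2 C y).sum_le ((hg' C y).trans (hg.1 C y).symm)
  have h2 : ∀ s : Finset (Fin M), ∑ m, seqProb W (C m) y * (if m ∈ s then (0 : ℝ) else 1) =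
      ∑ m, seqProb W (C m) y - ∑ m ∈ s, seqProb W (C m) y := by
    intro s
    rw [← Finset.sum_filter_add_sum_filter_not Finset.univ (· ∈ s) (fun m => seqProb W (C m) y)]
    simp [mul_ite, Finset.sum_ite]
  rw [h2, h2]
  linarith

variable [DecidableEq X] [DecidableEq Y]

lemma exists_isMMIListDecoder (hLM : L ≤ M) :
    ∃ g : ListDecoder X Y n M, IsMMIListDecoder L g := by
  choose g hg using fun (C : Fin M → Fin n → X) (y : Fin n → Y) =>
    exists_isTopList hLM (fun m => empMutualInfo (C m) y)
  exact ⟨g, fun C y => (hg C y).1, fun C y => (hg C y).2⟩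

omit [DecidableEq X] [DecidableEq Y] in
/-- Mutual information in terms of entropies. -/
lemma mutualInfo_eq_jointInfo {P : X × Y → ℝ} (hP : ∀ p, 0 ≤ P p) :
    mutualInfo P = jointInfo P := by
  have h1 : ∀ x y, P (x, y) * Real.log (P (x, y) / ((∑ y', P (x, y')) * (∑ x', P (x', y)))) =
      -Real.negMulLog (P (x, y)) - P (x, y) * Real.log (margX P x)
        - P (x, y) * Real.log (margY P y) := by
    intro x y
    rcases eq_or_lt_of_le (hP (x, y)) with h0 | h0
    · simp [← h0]
    have hx : 0 < margX P x := lt_of_lt_of_le h0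
      (Finset.single_le_sum (f := fun y => P (x, y)) (fun y _ => hP (x, y)) (Finset.mem_univ y))
    have hy : 0 < margY P y := lt_of_lt_of_le h0
      (Finset.single_le_sum (f := fun x => P (x, y)) (fun x _ => hP (x, y)) (Finset.mem_univ x))
    change P (x, y) * Real.log (P (x, y) / (margX P x * margY P y)) = _
    rw [Real.log_div h0.ne' (by positivity), Real.log_mul hx.ne' hy.ne', Real.negMulLog]
    ring
  unfold mutualInfo
  rw [Finset.sum_congr rfl fun x _ => Finset.sum_congr rfl fun y _ => h1 x y]
  simp only [Finset.sum_sub_distrib, Finset.sum_neg_distrib]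
  have h2 : ∑ x, ∑ y, Real.negMulLog (P (x, y)) = ent P := by
    rw [ent, Fintype.sum_prod_type]
  have h3 : ∑ x, ∑ y, P (x, y) * Real.log (margX P x) = - ent (margX P) := by
    rw [ent, ← Finset.sum_neg_distrib]
    refine Finset.sum_congr rfl fun x _ => ?_
    rw [← Finset.sum_mul, Real.negMulLog]
    change margX P x * _ = _
    ring
  have h4 : ∑ x, ∑ y, P (x, y) * Real.log (margY P y) = - ent (margY P) := by
    rw [ent, ← Finset.sum_neg_distrib, Finset.sum_comm]
    refine Finset.sum_congr rfl fun y _ => ?_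
    rw [← Finset.sum_mul, Real.negMulLog]
    change margY P y * _ = _
    ring
  rw [h2, h3, h4, jointInfo]
  ring

lemma empMutualInfo_eq (x : Fin n → X) (y : Fin n → Y) :
    empMutualInfo x y = jointInfo (empDist (pairSeq x y)) :=
  mutualInfo_eq_jointInfo (empDist_nonneg _)

lemma jointTypes_subset (Q : X → ℝ) : jointTypes n Q Y ⊆ types n (X × Y) :=
  fun _ hP => (mem_jointTypes.1 hP).1

lemma card_jointTypes_le (Q : X → ℝ) :
    ((jointTypes n Q Y).card : ℝ) ≤ Real.exp (Fintype.card (X × Y) * slack n) :=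
  le_trans (by exact_mod_cast Finset.card_le_card (jointTypes_subset Q)) card_types_le_exp

/-- The probability that an independent codeword has at least a given empirical mutual
information with the output. -/
lemma sum_uniformTypeClass_mul_ite_le (hn : 0 < n) (Q : X → ℝ) (y : Fin n → Y) (t : ℝ) :
    ∑ x, uniformTypeClass n Q x * (if t ≤ empMutualInfo x y then 1 else 0) ≤
      Real.exp (-(n * t) +
        (Fintype.card X + Fintype.card Y + Fintype.card (X × Y)) * slack n) := by
  simp_rw [empMutualInfo_eq]
  rw [sum_uniformTypeClass_mul_empDist Q y (fun P => if t ≤ jointInfo P then 1 else 0)]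
  have h1 : ∀ P ∈ jointTypes n Q Y, (if y ∈ typeClass n (margY P) then
      hitProb n P * (if t ≤ jointInfo P then 1 else 0) else 0) ≤
      Real.exp (-(n * t) + (Fintype.card X + Fintype.card Y) * slack n) := by
    intro P hP
    split_ifs with h1 h2
    · rw [mul_one]
      refine (hitProb_le hn (jointTypes_subset Q hP)).trans (Real.exp_le_exp.2 ?_)
      have : (n : ℝ) * t ≤ n * jointInfo P := mul_le_mul_of_nonneg_left h2 n.cast_nonneg
      linarith
    · rw [mul_zero]
      exact (Real.exp_pos _).le
    · exact (Real.exp_pos _).le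
  refine (Finset.sum_le_card_nsmul _ _ _ h1).trans ?_
  rw [nsmul_eq_mul]
  refine (mul_le_mul_of_nonneg_right (card_jointTypes_le Q) (Real.exp_pos _).le).trans ?_
  rw [← Real.exp_add]
  refine le_of_eq (congrArg _ ?_)
  ring

/-- Upper bound on the error probability of a maximum mutual information decoder. -/
lemma IsMMIListDecoder.avgListError_le (hW : IsChannel W) (hn : 0 < n) (hM : 0 < M) {Q : X → ℝ}
    (hQ : (typeClass n Q).Nonempty) {g : ListDecoder X Y n M} (hg : IsMMIListDecoder L g) :
    avgListError W (uniformTypeClass n Q) g ≤ ∑ P ∈ jointTypes n Q Y, typeMass W n P *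
      (min 1 (M * Real.exp (-(n * jointInfo P) +
        (Fintype.card X + Fintype.card Y + Fintype.card (X × Y)) * slack n))) ^ L := by
  have hM' : (0 : ℝ) < M := by exact_mod_cast hM
  rw [← sum_uniformTypeClass_mul_seqProb hW Q, avgListError_eq, Finset.mul_sum]
  refine Finset.sum_le_sum fun y _ => ?_
  rw [one_div, inv_mul_le_iff₀ hM']
  simp_rw [Finset.mul_sum (s := (Finset.univ : Finset (Fin M)))]
  rw [Finset.sum_comm]
  -- One bound serves all M messages, which cancels the prefactor 1/M.
  refine le_trans (Finset.sum_le_card_nsmul _ _ (∑ x, uniformTypeClass n Q x * (seqProb W x y *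
    (min 1 (M * ∑ x', uniformTypeClass n Q x' *
      (if empMutualInfo x y ≤ empMutualInfo x' y then 1 else 0))) ^ L)) ?_) ?_
  · intro m _
    refine sum_prod_mul_le_min (sum_uniformTypeClass hQ) (uniformTypeClass_nonneg Q) m
      (f := fun x => seqProb W x y)
      (r := fun x x' => if empMutualInfo x y ≤ empMutualInfo x' y then 1 else 0)
      (fun x => seqProb_nonneg hW x y) ?_ ?_ ?_
    · intro a b
      split_ifs <;> norm_num
    · intro C
      split_ifs <;> norm_num
    · intro C
      have hnn : ∀ S ∈ (Finset.univ.erase m).powersetCard L, (0 : ℝ) ≤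
          ∏ i ∈ S, (if empMutualInfo (C m) y ≤ empMutualInfo (C i) y then 1 else 0) :=
        fun S _ => Finset.prod_nonneg fun i _ => by split_ifs <;> norm_num
      split_ifs with hm
      · exact Finset.sum_nonneg hnn
      -- If m is missed, the list itself is an L-subset of the other messages, all scoring at least
      -- as high as m, so its term in the union bound equals one.
      · have hS : g C y ∈ (Finset.univ.erase m).powersetCard L :=
          Finset.mem_powersetCard.2 ⟨fun i hi => Finset.mem_erase.2
            ⟨fun h => hm (h ▸ hi), Finset.mem_univ i⟩, hg.1 C y⟩
        refine le_trans (le_of_eq ?_) (Finset.single_le_sum hnn hS)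
        symm
        refine Finset.prod_eq_one fun i hi => ?_
        rw [if_pos (hg.2 C y i hi m hm)]
  · rw [Finset.card_univ, Fintype.card_fin, nsmul_eq_mul]
    refine mul_le_mul_of_nonneg_left (Finset.sum_le_sum fun x _ => ?_) hM'.le
    refine mul_le_mul_of_nonneg_left (mul_le_mul_of_nonneg_left ?_ (seqProb_nonneg hW x y))
      (uniformTypeClass_nonneg Q x)
    refine pow_le_pow_left₀ (le_min zero_le_one (mul_nonneg hM'.le (Finset.sum_nonneg
      fun x' _ => mul_nonneg (uniformTypeClass_nonneg Q x') (by split_ifs <;> norm_num)))) ?_ L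
    refine min_le_min le_rfl (mul_le_mul_of_nonneg_left ?_ hM'.le)
    have := sum_uniformTypeClass_mul_ite_le hn Q y (empMutualInfo x y)
    rwa [empMutualInfo_eq x y] at this ⊢

/-- The codewords of type `P` with `y` that exceed the list size cause errors. -/
lemma typeProb_mul_surplus_le (hW : IsChannel W) {g : ListDecoder X Y n M} (hg : HasListSize L g)
    (P : X × Y → ℝ) (y : Fin n → Y) (C : Fin M → Fin n → X) :
    typeProb W n P * max (((Finset.univ.filter fun m => C m ∈ condClass P y).card : ℝ) - L) 0 ≤
      ∑ m, seqProb W (C m) y * (if m ∈ g C y then 0 else 1) := by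
  have hnn : ∀ m, 0 ≤ seqProb W (C m) y * (if m ∈ g C y then (0 : ℝ) else 1) := fun m =>
    mul_nonneg (seqProb_nonneg hW _ _) (by split_ifs <;> norm_num)
  rw [mul_max_of_nonneg _ _ (typeProb_nonneg W P), mul_zero]
  refine max_le ?_ (Finset.sum_nonneg fun m _ => hnn m)
  refine le_trans ?_ (Finset.sum_le_sum_of_subset_of_nonneg
    (Finset.subset_univ ((Finset.univ.filter fun m => C m ∈ condClass P y) \ g C y))
    fun m _ _ => hnn m)
  rw [Finset.sum_congr rfl (g := fun _ => typeProb W n P)]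
  · rw [Finset.sum_const, nsmul_eq_mul, mul_comm]
    refine mul_le_mul_of_nonneg_right ?_ (typeProb_nonneg W P)
    rw [sub_le_iff_le_add]
    have := Finset.le_card_sdiff (g C y) (Finset.univ.filter fun m => C m ∈ condClass P y)
    rw [hg C y] at this
    have h2 : (Finset.univ.filter fun m => C m ∈ condClass P y).card ≤
      ((Finset.univ.filter fun m => C m ∈ condClass P y) \ g C y).card + L := by omega
    exact_mod_cast h2
  · intro m hm
    obtain ⟨h1, h2⟩ := Finset.mem_sdiff.1 hm
    rw [if_neg h2, mul_one, seqProb_eq_typeProb hW, mem_condClass.1 (Finset.mem_filter.1 h1).2]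

lemma sum_condClass_uniformTypeClass {Q : X → ℝ} {P : X × Y → ℝ} (hP : P ∈ jointTypes n Q Y)
    {y : Fin n → Y} (hy : y ∈ typeClass n (margY P)) :
    ∑ x ∈ condClass P y, uniformTypeClass n Q x = hitProb n P := by
  obtain ⟨hP1, hP2⟩ := mem_jointTypes.1 hP
  rw [← card_condClass_div hP1 (mem_typeClass.1 hy), hP2,
    Finset.sum_congr rfl (g := fun _ => 1 / ((typeClass n Q).card : ℝ))]
  · rw [Finset.sum_const, nsmul_eq_mul]
    ring
  · intro x hx
    rw [uniformTypeClass, if_pos]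
    rw [mem_typeClass, ← hP2, ← mem_condClass.1 hx, margX_empDist]

/-- Lower bound on the error probability of an arbitrary list decoder. -/
lemma le_avgListError (hW : IsChannel W) (hL : 1 ≤ L) (hM : 4 * L ≤ M) {Q : X → ℝ}
    (hQ : (typeClass n Q).Nonempty) {g : ListDecoder X Y n M} (hg : HasListSize L g)
    {P : X × Y → ℝ} (hP : P ∈ jointTypes n Q Y) :
    surplusConst L * (typeMass W n P * (min 1 (M * hitProb n P)) ^ L) ≤
      avgListError W (uniformTypeClass n Q) g := by
  have hM' : (0 : ℝ) < M := by exact_mod_cast (show 0 < M by omega)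
  rw [avgListError_eq, one_div, le_inv_mul_iff₀ hM',
    ← card_mul_hitProb_mul_typeProb (mem_jointTypes.1 hP).1]
  -- For each output of the right type, the mean surplus of codewords times their common likelihood
  -- bounds the off-list likelihood. Its factor M · `hitProb` absorbs the 1/M, and what remains sums
  -- over outputs to `typeMass`.
  have h1 : ∀ y : Fin n → Y, (if y ∈ typeClass n (margY P) then typeProb W n P *
      (surplusConst L * (M * hitProb n P) * (min 1 (M * hitProb n P)) ^ L) else 0) ≤
      ∑ C : Fin M → Fin n → X, (∏ m, uniformTypeClass n Q (C m)) *
        ∑ m, seqProb W (C m) y * (if m ∈ g C y then 0 else 1) := by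
    intro y
    have hPC : ∀ C : Fin M → Fin n → X, 0 ≤ ∏ m, uniformTypeClass n Q (C m) :=
      fun C => Finset.prod_nonneg fun m _ => uniformTypeClass_nonneg Q _
    split_ifs with hy
    · have h2 := le_sum_prod_mul_surplus (sum_uniformTypeClass hQ) (uniformTypeClass_nonneg Q)
        hL hM (condClass P y)
      rw [sum_condClass_uniformTypeClass hP hy] at h2
      refine (mul_le_mul_of_nonneg_left h2 (typeProb_nonneg W P)).trans ?_
      rw [Finset.mul_sum]
      refine Finset.sum_le_sum fun C _ => ?_
      rw [mul_left_comm]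
      exact mul_le_mul_of_nonneg_left (typeProb_mul_surplus_le hW hg P y C) (hPC C)
    · refine Finset.sum_nonneg fun C _ => mul_nonneg (hPC C) (Finset.sum_nonneg fun m _ =>
        mul_nonneg (seqProb_nonneg hW _ _) (by split_ifs <;> norm_num))
  refine le_trans (le_of_eq ?_) (Finset.sum_le_sum fun y _ => h1 y)
  rw [sum_ite_mem_typeClass]
  ring

/-- The expression minimized over `ρ` in the Gallager bound. -/
noncomputable def gallagerFun (W : X → Y → ℝ) (U : (Fin n → X) → ℝ) (M : ℕ) (ρ : ℝ) : ℝ :=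
  (M : ℝ) ^ ρ * ∑ y : Fin n → Y, (∑ x : Fin n → X, U x * seqProb W x y ^ (1 / (1 + ρ))) ^ (1 + ρ)

lemma inner_gallagerFun_eq (hW : IsChannel W) (Q : X → ℝ) (y : Fin n → Y) (ρ : ℝ) :
    ∑ x : Fin n → X, uniformTypeClass n Q x * seqProb W x y ^ (1 / (1 + ρ)) =
      ∑ P ∈ jointTypes n Q Y, (if y ∈ typeClass n (margY P) then
        hitProb n P * typeProb W n P ^ (1 / (1 + ρ)) else 0) := by
  rw [← sum_uniformTypeClass_mul_empDist Q y (fun P => typeProb W n P ^ (1 / (1 + ρ)))]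
  refine Finset.sum_congr rfl fun x _ => ?_
  rw [seqProb_eq_typeProb hW]

/-- The likelihood returns to its first power while `hitProb` keeps an extra exponent ρ, the source
of the term ρI. -/
lemma hitProb_mul_rpow (P : X × Y → ℝ) {ρ : ℝ} (hρ : 0 ≤ ρ) :
    (hitProb n P * typeProb W n P ^ (1 / (1 + ρ))) ^ (1 + ρ) =
      hitProb n P * typeProb W n P * hitProb n P ^ ρ := by
  have h1 : 0 < 1 + ρ := by linarith
  rw [Real.mul_rpow (hitProb_nonneg P) (Real.rpow_nonneg (typeProb_nonneg W P) _),
    ← Real.rpow_mul (typeProb_nonneg W P), one_div_mul_cancel h1.ne', Real.rpow_one,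
    Real.rpow_add_of_nonneg (hitProb_nonneg P) zero_le_one hρ, Real.rpow_one]
  ring

/-- For z ≥ 1 the right side is at least one; for z ≤ 1 a smaller exponent gives a larger power. The
point z = 0 is separate because ρ = 0 gives 0^0 = 1. -/
lemma min_one_pow_le_rpow {z ρ : ℝ} (hz : 0 ≤ z) (hρ : 0 ≤ ρ) (hρL : ρ ≤ L) :
    (min 1 z) ^ L ≤ z ^ ρ := by
  rcases le_total 1 z with h | h
  · rw [min_eq_left h, one_pow]
    exact Real.one_le_rpow h hρ
  · rw [min_eq_right h, ← Real.rpow_natCast]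
    rcases eq_or_lt_of_le hz with h0 | h0
    · rw [← h0]
      rcases eq_or_lt_of_le hρ with h1 | h1
      · rw [← h1, Real.rpow_zero]
        exact Real.zero_rpow_le_one _
      · rw [Real.zero_rpow h1.ne', Real.zero_rpow (h1.trans_le hρL).ne']
    · exact Real.rpow_le_rpow_of_exponent_ge h0 h hρL

/-- Only the one joint type P is kept in the inner sum. The left side does not involve ρ, so the
bound will survive the infimum. -/
lemma le_gallagerFun (hW : IsChannel W) {Q : X → ℝ} {P : X × Y → ℝ} (hP : P ∈ jointTypes n Q Y)
    {ρ : ℝ} (hρ : 0 ≤ ρ) (hρL : ρ ≤ L) :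
    typeMass W n P * (min 1 (M * hitProb n P)) ^ L ≤
      gallagerFun W (uniformTypeClass n Q) M ρ := by
  have h1ρ : 0 ≤ 1 + ρ := by linarith
  have hMρ : (0 : ℝ) ≤ (M : ℝ) ^ ρ := by positivity
  refine (mul_le_mul_of_nonneg_left (min_one_pow_le_rpow
    (mul_nonneg M.cast_nonneg (hitProb_nonneg P)) hρ hρL) (typeMass_nonneg W P)).trans ?_
  rw [Real.mul_rpow M.cast_nonneg (hitProb_nonneg P), mul_left_comm, gallagerFun]
  refine mul_le_mul_of_nonneg_left ?_ hMρ
  rw [← card_mul_hitProb_mul_typeProb (mem_jointTypes.1 hP).1, mul_assoc, ← hitProb_mul_rpow P hρ,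
    ← sum_ite_mem_typeClass]
  refine Finset.sum_le_sum fun y _ => ?_
  rw [inner_gallagerFun_eq hW]
  have hnn : ∀ P' ∈ jointTypes n Q Y, 0 ≤ (if y ∈ typeClass n (margY P') then
      hitProb n P' * typeProb W n P' ^ (1 / (1 + ρ)) else 0) := by
    intro P' _
    split_ifs
    · exact mul_nonneg (hitProb_nonneg P') (Real.rpow_nonneg (typeProb_nonneg W P') _)
    · exact le_rfl
  split_ifs with hy
  · refine Real.rpow_le_rpow
      (mul_nonneg (hitProb_nonneg P) (Real.rpow_nonneg (typeProb_nonneg W P) _)) ?_ h1ρ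
    have := Finset.single_le_sum hnn hP
    rwa [if_pos hy] at this
  · exact Real.rpow_nonneg (Finset.sum_nonneg hnn) _

/-- By the power mean inequality, moving the exponent 1 + ρ inside a sum of N terms costs only N^ρ,
and the number of joint types is polynomial. -/
lemma gallagerFun_le (hW : IsChannel W) (Q : X → ℝ) {ρ : ℝ} (hρ : 0 ≤ ρ) :
    gallagerFun W (uniformTypeClass n Q) M ρ ≤
      ((jointTypes n Q Y).card : ℝ) ^ ρ *
        ∑ P ∈ jointTypes n Q Y, typeMass W n P * (M * hitProb n P) ^ ρ := by
  have h1ρ : 1 + ρ ≠ 0 := by linarith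
  have hMρ : (0 : ℝ) ≤ (M : ℝ) ^ ρ := by positivity
  have h1 : ∀ y : Fin n → Y,
      (∑ x : Fin n → X, uniformTypeClass n Q x * seqProb W x y ^ (1 / (1 + ρ))) ^ (1 + ρ) ≤
      ((jointTypes n Q Y).card : ℝ) ^ ρ * ∑ P ∈ jointTypes n Q Y,
        (if y ∈ typeClass n (margY P) then
          hitProb n P * typeProb W n P * hitProb n P ^ ρ else 0) := by
    intro y
    rw [inner_gallagerFun_eq hW]
    refine (Real.rpow_sum_le_const_mul_sum_rpow_of_nonneg _ (by linarith) ?_).trans ?_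
    · intro P _
      split_ifs
      · exact mul_nonneg (hitProb_nonneg P) (Real.rpow_nonneg (typeProb_nonneg W P) _)
      · exact le_rfl
    · rw [add_sub_cancel_left]
      refine le_of_eq (congrArg _ (Finset.sum_congr rfl fun P _ => ?_))
      split_ifs
      · exact hitProb_mul_rpow P hρ
      · exact Real.zero_rpow h1ρ
  rw [gallagerFun]
  refine (mul_le_mul_of_nonneg_left (Finset.sum_le_sum fun y _ => h1 y) hMρ).trans (le_of_eq ?_)
  rw [← Finset.mul_sum, Finset.sum_comm, mul_left_comm]
  congr 1
  rw [Finset.mul_sum]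
  refine Finset.sum_congr rfl fun P hP => ?_
  rw [sum_ite_mem_typeClass, ← card_mul_hitProb_mul_typeProb (mem_jointTypes.1 hP).1,
    Real.mul_rpow M.cast_nonneg (hitProb_nonneg P)]
  ring

end Decoders

/-! ### Exponents as functions of couplings: continuity, convexity, saddle point, approximation -/

section Couplings

variable {X Y : Type*} [Fintype X] [Fintype Y] {W : X → Y → ℝ} {Q : X → ℝ}

/-- The joint distribution of the input `Q` and the output of the channel `V`. -/
def joint (Q : X → ℝ) (V : X → Y → ℝ) : X × Y → ℝ := fun p => Q p.1 * V p.1 p.2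

/-- The joint distributions with first marginal `Q` that vanish where `W` does. -/
def coupl (W : X → Y → ℝ) (Q : X → ℝ) : Set (X × Y → ℝ) :=
  {P | (∀ p, 0 ≤ P p) ∧ margX P = Q ∧ Compat W P}

/-- The channels that vanish where `W` does. -/
def acChannels (W : X → Y → ℝ) : Set (X → Y → ℝ) :=
  {V | IsChannel V ∧ ∀ x y, W x y = 0 → V x y = 0}

/-- `D + L [I - R]₊` as a function of the joint distribution. -/
noncomputable def listExp (W : X → Y → ℝ) (R : ℝ) (L : ℕ) (P : X × Y → ℝ) : ℝ :=
  jointDiv W P + L * max 0 (jointInfo P - R)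

/-- `D + ρ (I - R)` as a function of the joint distribution. -/
noncomputable def rhoExp (W : X → Y → ℝ) (R ρ : ℝ) (P : X × Y → ℝ) : ℝ :=
  jointDiv W P + ρ * (jointInfo P - R)

lemma rhoExp_le_listExp {R ρ : ℝ} {L : ℕ} (hρ : 0 ≤ ρ) (hρL : ρ ≤ L) (P : X × Y → ℝ) :
    rhoExp W R ρ P ≤ listExp W R L P := by
  refine add_le_add le_rfl ?_
  exact (mul_le_mul_of_nonneg_left (le_max_right 0 _) hρ).trans
    (mul_le_mul_of_nonneg_right hρL (le_max_left 0 _))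

/-- An affine function of ρ on [0, L] is largest at an endpoint, chosen by the sign of I - R. -/
lemma exists_rhoExp_eq_listExp (R : ℝ) (L : ℕ) (P : X × Y → ℝ) :
    ∃ ρ ∈ Set.Icc (0 : ℝ) L, rhoExp W R ρ P = listExp W R L P := by
  rcases le_total (jointInfo P - R) 0 with h | h
  · exact ⟨0, ⟨le_rfl, L.cast_nonneg⟩, by simp [rhoExp, listExp, max_eq_left h]⟩
  · exact ⟨L, ⟨L.cast_nonneg, le_rfl⟩, by simp [rhoExp, listExp, max_eq_right h]⟩

@[fun_prop]
lemma continuous_ent {A : Type*} [Fintype A] : Continuous (ent : (A → ℝ) → ℝ) := by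
  unfold ent
  exact continuous_finsetSum _ fun a _ => Real.continuous_negMulLog.comp (continuous_apply a)

omit [Fintype X] in
@[fun_prop]
lemma continuous_margX : Continuous (margX : (X × Y → ℝ) → X → ℝ) := by
  unfold margX
  fun_prop

omit [Fintype Y] in
@[fun_prop]
lemma continuous_margY : Continuous (margY : (X × Y → ℝ) → Y → ℝ) := by
  unfold margY
  fun_prop

@[fun_prop]
lemma continuous_jointInfo : Continuous (jointInfo : (X × Y → ℝ) → ℝ) := by
  unfold jointInfo
  fun_prop

-- Written with entropies, the divergence is continuous on the whole space: the term with log W is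
-- linear in P with fixed real coefficients. The infinite values are kept out by `Compat` instead.
@[fun_prop]
lemma continuous_jointDiv (W : X → Y → ℝ) : Continuous (jointDiv W) := by
  unfold jointDiv
  fun_prop

@[fun_prop]
lemma continuous_listExp (W : X → Y → ℝ) (R : ℝ) (L : ℕ) : Continuous (listExp W R L) := by
  unfold listExp
  fun_prop

@[fun_prop]
lemma continuous_rhoExp (W : X → Y → ℝ) (R ρ : ℝ) : Continuous (rhoExp W R ρ) := by
  unfold rhoExp
  fun_prop

omit [Fintype X] [Fintype Y] in
lemma continuous_joint : Continuous fun p : (X → ℝ) × (X → Y → ℝ) => joint p.1 p.2 := by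
  unfold joint
  fun_prop

omit [Fintype X] in
lemma margX_joint {V : X → Y → ℝ} (hV : IsChannel V) : margX (joint Q V) = Q := by
  ext x
  simp only [margX, joint]
  rw [← Finset.mul_sum, (hV x).2, mul_one]

omit [Fintype X] in
lemma joint_mem_coupl (hQ : ∀ x, 0 ≤ Q x) {V : X → Y → ℝ} (hV : IsChannel V)
    (h : ∀ x y, 0 < Q x → W x y = 0 → V x y = 0) : joint Q V ∈ coupl W Q := by
  refine ⟨fun p => mul_nonneg (hQ _) ((hV _).1 _), margX_joint hV, fun p hp => ?_⟩
  rcases eq_or_lt_of_le (hQ p.1) with h0 | h0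
  · rw [joint, ← h0, zero_mul]
  · rw [joint, h _ _ h0 hp, mul_zero]

omit [Fintype X] in
lemma exists_joint_eq (hW : IsChannel W) {P : X × Y → ℝ} (hP : P ∈ coupl W Q) :
    ∃ V ∈ acChannels W, joint Q V = P := by
  obtain ⟨h0, h1, h2⟩ := hP
  have hQ : ∀ x, 0 ≤ Q x := fun x => by
    rw [← h1]
    exact Finset.sum_nonneg fun y _ => h0 (x, y)
  have hz : ∀ x y, Q x = 0 → P (x, y) = 0 := by
    intro x y hx
    rw [← h1] at hx
    exact (Finset.sum_eq_zero_iff_of_nonneg fun y _ => h0 (x, y)).1 hx y (Finset.mem_univ y)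
  -- Disintegration of P. On letters of zero mass the row of W is a valid choice that still vanishes
  -- where W does.
  refine ⟨fun x y => if Q x = 0 then W x y else P (x, y) / Q x, ⟨fun x => ⟨fun y => ?_, ?_⟩,
    fun x y hxy => ?_⟩, ?_⟩
  · dsimp only
    split_ifs
    · exact (hW x).1 y
    · exact div_nonneg (h0 _) (hQ x)
  · dsimp only
    split_ifs with hx
    · exact (hW x).2
    · rw [← Finset.sum_div]
      have : ∑ y, P (x, y) = Q x := congrFun h1 x
      rw [this, div_self hx]
  · dsimp only
    split_ifs
    · exact hxy
    · rw [h2 (x, y) hxy, zero_div]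
  · ext ⟨x, y⟩
    simp only [joint]
    split_ifs with hx
    · rw [hx, zero_mul, hz x y hx]
    · field_simp

omit [Fintype X] in
lemma joint_self_mem_coupl (hW : IsChannel W) (hQ : ∀ x, 0 ≤ Q x) : joint Q W ∈ coupl W Q :=
  joint_mem_coupl hQ hW fun _ _ _ h => h

-- A closed subset of a product of simplices. Vanishing is required even at letters of zero Q-mass,
-- so the set does not depend on Q and serves all nearby inputs at once.
omit [Fintype X] in
lemma isCompact_acChannels (W : X → Y → ℝ) : IsCompact (acChannels W) := by
  have h1 : acChannels W = (Set.univ.pi fun _ => stdSimplex ℝ Y) ∩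
      {V | ∀ x y, W x y = 0 → V x y = 0} := by
    ext V
    simp [acChannels, IsChannel]
  rw [h1]
  refine (isCompact_univ_pi fun _ => isCompact_stdSimplex ℝ Y).inter_right ?_
  simp only [Set.ofPred_forall]
  refine isClosed_iInter fun x => isClosed_iInter fun y => isClosed_iInter fun _ =>
    isClosed_eq (by fun_prop) continuous_const

omit [Fintype X] in
lemma coupl_eq_image (hW : IsChannel W) (hQ : ∀ x, 0 ≤ Q x) :
    coupl W Q = joint Q '' acChannels W := by
  ext P
  constructor
  · intro hP
    obtain ⟨V, hV, h⟩ := exists_joint_eq hW hP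
    exact ⟨V, hV, h⟩
  · rintro ⟨V, hV, rfl⟩
    exact joint_mem_coupl hQ hV.1 fun x y _ h => hV.2 x y h

omit [Fintype X] in
lemma isCompact_coupl (hW : IsChannel W) (hQ : ∀ x, 0 ≤ Q x) : IsCompact (coupl W Q) := by
  rw [coupl_eq_image hW hQ]
  exact (isCompact_acChannels W).image
    (continuous_joint.comp (Continuous.prodMk continuous_const continuous_id))

omit [Fintype X] in
lemma margX_add_smul (a b : ℝ) (P P' : X × Y → ℝ) :
    margX (a • P + b • P') = a • margX P + b • margX P' := by
  ext x
  simp [margX, Finset.sum_add_distrib, Finset.mul_sum]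

omit [Fintype Y] in
lemma margY_add_smul (a b : ℝ) (P P' : X × Y → ℝ) :
    margY (a • P + b • P') = a • margY P + b • margY P' := by
  ext x
  simp [margY, Finset.sum_add_distrib, Finset.mul_sum]

omit [Fintype X] in
lemma convex_coupl : Convex ℝ (coupl W Q) := by
  intro P hP P' hP' a b ha hb hab
  refine ⟨fun p => ?_, ?_, fun p hp => ?_⟩
  · have := hP.1 p
    have := hP'.1 p
    simp only [Pi.add_apply, Pi.smul_apply, smul_eq_mul]
    positivity
  · rw [margX_add_smul, hP.2.1, hP'.2.1, ← add_smul, hab, one_smul]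
  · simp [hP.2.2 p hp, hP'.2.2 p hp]

lemma ent_concave {A : Type*} [Fintype A] {P P' : A → ℝ} (hP : ∀ a, 0 ≤ P a)
    (hP' : ∀ a, 0 ≤ P' a) {a b : ℝ} (ha : 0 ≤ a) (hb : 0 ≤ b) (hab : a + b = 1) :
    a * ent P + b * ent P' ≤ ent (a • P + b • P') := by
  unfold ent
  rw [Finset.mul_sum, Finset.mul_sum, ← Finset.sum_add_distrib]
  refine Finset.sum_le_sum fun i _ => ?_
  exact Real.concaveOn_negMulLog.2 (hP i) (hP' i) ha hb hab

/-- The tangent plane at (u, q) to the convex, homogeneous function u log(u/q) lies below it; this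
is log t ≤ t - 1 at t = uq'/(qu'). -/
lemma mul_log_sub_tangent {u q u' q' : ℝ} (hu : 0 < u) (hq : 0 < q) (hu' : 0 ≤ u')
    (huq' : u' ≤ q') :
    u' * (Real.log u - Real.log q) + u' - u * q' / q ≤ u' * (Real.log u' - Real.log q') := by
  rcases eq_or_lt_of_le hu' with h0 | h0
  · rw [← h0]
    have hq' : 0 ≤ q' := hu'.trans huq'
    have : 0 ≤ u * q' / q := by positivity
    linarith
  · have hq' : 0 < q' := h0.trans_le huq'
    have h := Real.log_le_sub_one_of_pos (x := u * q' / (q * u')) (by positivity)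
    rw [Real.log_div (by positivity) (by positivity), Real.log_mul hu.ne' hq'.ne',
      Real.log_mul hq.ne' h0.ne'] at h
    have h2 := mul_le_mul_of_nonneg_left h h0.le
    have h3 : u' * (u * q' / (q * u') - 1) = u * q' / q - u' := by
      field_simp
    rw [h3] at h2
    linarith

/-- The two-term log-sum inequality. -/
lemma log_sum_two {u₁ u₂ q₁ q₂ a b : ℝ} (hu₁ : 0 ≤ u₁) (hu₂ : 0 ≤ u₂) (h₁ : u₁ ≤ q₁)
    (h₂ : u₂ ≤ q₂) (ha : 0 ≤ a) (hb : 0 ≤ b) :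
    (a * u₁ + b * u₂) * (Real.log (a * u₁ + b * u₂) - Real.log (a * q₁ + b * q₂)) ≤
      a * (u₁ * (Real.log u₁ - Real.log q₁)) + b * (u₂ * (Real.log u₂ - Real.log q₂)) := by
  have hau := mul_nonneg ha hu₁
  have hbu := mul_nonneg hb hu₂
  have haq := mul_le_mul_of_nonneg_left h₁ ha
  have hbq := mul_le_mul_of_nonneg_left h₂ hb
  rcases eq_or_lt_of_le (add_nonneg hau hbu) with h0 | h0
  · have e1 : a * u₁ = 0 := by linarith
    have e2 : b * u₂ = 0 := by linarith
    rw [← h0, ← mul_assoc, ← mul_assoc, e1, e2]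
    simp
  · have hq : 0 < a * q₁ + b * q₂ := by linarith
    -- Both points are compared with the tangent plane at their combination (u, q); the linear
    -- corrections cancel in the weighted sum.
    have t1 := mul_le_mul_of_nonneg_left (mul_log_sub_tangent h0 hq hu₁ h₁) ha
    have t2 := mul_le_mul_of_nonneg_left (mul_log_sub_tangent h0 hq hu₂ h₂) hb
    set u := a * u₁ + b * u₂ with hu
    set q := a * q₁ + b * q₂ with hq_def
    have h3 : a * (u * q₁ / q) + b * (u * q₂ / q) = u := by
      have : a * (u * q₁ / q) + b * (u * q₂ / q) = u * q / q := by
        rw [hq_def]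
        ring
      rw [this, mul_div_cancel_right₀ _ hq.ne']
    have h4 : u * (Real.log u - Real.log q) = a * (u₁ * (Real.log u - Real.log q)) +
        b * (u₂ * (Real.log u - Real.log q)) := by
      rw [hu]
      ring
    rw [h4]
    linarith

/-- Writes the negative conditional entropy of the input given the output as a sum of terms u
log(u/q), to which the log-sum inequality applies. -/
lemma ent_margY_sub_ent (P : X × Y → ℝ) :
    ent (margY P) - ent P =
      ∑ x, ∑ y, P (x, y) * (Real.log (P (x, y)) - Real.log (margY P y)) := by
  simp only [mul_sub, Finset.sum_sub_distrib]
  have h1 : ent P = - ∑ x, ∑ y, P (x, y) * Real.log (P (x, y)) := by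
    rw [ent, Fintype.sum_prod_type]
    simp [Real.negMulLog]
  have h2 : ent (margY P) = - ∑ x, ∑ y, P (x, y) * Real.log (margY P y) := by
    rw [Finset.sum_comm, ent, ← Finset.sum_neg_distrib]
    refine Finset.sum_congr rfl fun y _ => ?_
    rw [← Finset.sum_mul, Real.negMulLog]
    change - margY P y * _ = -(margY P y * _)
    ring
  rw [h1, h2]
  ring

lemma ent_margY_sub_ent_convex {P P' : X × Y → ℝ} (hP : ∀ p, 0 ≤ P p) (hP' : ∀ p, 0 ≤ P' p)
    {a b : ℝ} (ha : 0 ≤ a) (hb : 0 ≤ b) :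
    ent (margY (a • P + b • P')) - ent (a • P + b • P') ≤
      a * (ent (margY P) - ent P) + b * (ent (margY P') - ent P') := by
  rw [ent_margY_sub_ent, ent_margY_sub_ent, ent_margY_sub_ent, margY_add_smul, Finset.mul_sum,
    Finset.mul_sum, ← Finset.sum_add_distrib]
  refine Finset.sum_le_sum fun x _ => ?_
  rw [Finset.mul_sum, Finset.mul_sum, ← Finset.sum_add_distrib]
  refine Finset.sum_le_sum fun y _ => ?_
  have h1 : P (x, y) ≤ margY P y :=
    Finset.single_le_sum (f := fun x => P (x, y)) (fun x _ => hP (x, y)) (Finset.mem_univ x)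
  have h2 : P' (x, y) ≤ margY P' y :=
    Finset.single_le_sum (f := fun x => P' (x, y)) (fun x _ => hP' (x, y)) (Finset.mem_univ x)
  exact log_sum_two (hP _) (hP' _) h1 h2 ha hb

/-- On couplings of Q the entropy of the first marginal is constant. What remains is minus the joint
entropy, a linear term, and ρ ≥ 0 times the convex negative conditional entropy. -/
lemma convexOn_rhoExp (R : ℝ) {ρ : ℝ} (hρ : 0 ≤ ρ) :
    ConvexOn ℝ (coupl W Q) (rhoExp W R ρ) := by
  refine ⟨convex_coupl, fun P hP P' hP' a b ha hb hab => ?_⟩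
  have hm := (convex_coupl hP hP' ha hb hab).2.1
  have h1 := ent_concave hP.1 hP'.1 ha hb hab
  have h2 := mul_le_mul_of_nonneg_left (ent_margY_sub_ent_convex hP.1 hP'.1 ha hb) hρ
  have h3 : ∑ p : X × Y, (a • P + b • P') p * Real.log (W p.1 p.2) =
      a * ∑ p : X × Y, P p * Real.log (W p.1 p.2) +
      b * ∑ p : X × Y, P' p * Real.log (W p.1 p.2) := by
    rw [Finset.mul_sum, Finset.mul_sum, ← Finset.sum_add_distrib]
    refine Finset.sum_congr rfl fun p _ => ?_
    simp only [Pi.add_apply, Pi.smul_apply, smul_eq_mul]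
    ring
  simp only [rhoExp, jointDiv, jointInfo, smul_eq_mul]
  rw [hm, hP.2.1, hP'.2.1, h3]
  obtain rfl : b = 1 - a := by linarith
  linear_combination h1 + h2

/-- The saddle point behind the exchange of the minimum and the maximum. -/
lemma exists_saddle (hW : IsChannel W) (hQ : ∀ x, 0 ≤ Q x) (R : ℝ) (L : ℕ) :
    ∃ P₀ ∈ coupl W Q, ∃ ρ₀ ∈ Set.Icc (0 : ℝ) L, ∀ P ∈ coupl W Q,
      listExp W R L P₀ ≤ rhoExp W R ρ₀ P := by
  obtain ⟨P₀, hP₀, ρ₀, hρ₀, h⟩ := Sion.exists_isSaddlePointOn (X := coupl W Q)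
    (Y := Set.Icc (0 : ℝ) L) (f := fun P ρ => rhoExp W R ρ P)
    ⟨_, joint_self_mem_coupl hW hQ⟩ convex_coupl (isCompact_coupl hW hQ)
    (fun ρ _ => (continuous_rhoExp W R ρ).lowerSemicontinuous.lowerSemicontinuousOn _)
    (fun ρ hρ => (convexOn_rhoExp R hρ.1).quasiconvexOn)
    (convex_Icc _ _) ⟨0, le_rfl, L.cast_nonneg⟩ isCompact_Icc
    (fun P _ => by
      have : Continuous fun ρ => rhoExp W R ρ P := by
        unfold rhoExp
        fun_prop
      exact this.upperSemicontinuous.upperSemicontinuousOn _)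
    (fun P _ => by
      refine ConcaveOn.quasiconcaveOn ⟨convex_Icc _ _, fun ρ _ ρ' _ a b _ _ hab => ?_⟩
      simp only [rhoExp, smul_eq_mul]
      obtain rfl : b = 1 - a := by linarith
      linarith)
  refine ⟨P₀, hP₀, ρ₀, hρ₀, fun P hP => ?_⟩
  -- In the saddle inequality the free multiplier is set to the one attaining the maximum at P₀.
  obtain ⟨ρ, hρ, hρe⟩ := exists_rhoExp_eq_listExp (W := W) R L P₀
  rw [← hρe]
  exact h P hP ρ hρ

omit [Fintype X] in
/-- Lower bounds on the couplings of `Q` nearly hold for the couplings of nearby inputs. -/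
lemma eventually_forall_coupl_le (hW : IsChannel W) (hQ : ∀ x, 0 ≤ Q x) {h : (X × Y → ℝ) → ℝ}
    (hh : Continuous h) {E ε : ℝ} (hε : 0 < ε) (hE : ∀ P ∈ coupl W Q, E ≤ h P) :
    ∀ᶠ Q' in 𝓝 Q, ∀ P ∈ coupl W Q', E - ε ≤ h P := by
  -- A strict inequality at each channel spreads to a neighbourhood in (Q', V); compactness makes
  -- the neighbourhood of Q uniform in V.
  have h1 : ∀ᶠ Q' in 𝓝 Q, ∀ V ∈ acChannels W, E - ε < h (joint Q' V) := by
    refine (isCompact_acChannels W).eventually_forall_of_forall_eventually fun V hV => ?_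
    have hc : Continuous fun z : (X → ℝ) × (X → Y → ℝ) => h (joint z.1 z.2) :=
      hh.comp continuous_joint
    have hlt : E - ε < h (joint Q V) := by
      have := hE (joint Q V) (joint_mem_coupl hQ hV.1 fun x y _ h => hV.2 x y h)
      linarith
    exact hc.continuousAt.eventually (lt_mem_nhds hlt)
  filter_upwards [h1] with Q' hQ' P hP
  obtain ⟨V, hV, rfl⟩ := exists_joint_eq hW hP
  exact (hQ' V hV).le

omit [Fintype X] in
/-- Rounding a distribution to integer counts. -/
lemma exists_counts [DecidableEq Y] (N : ℕ) {v : Y → ℝ} (hv : v ∈ stdSimplex ℝ Y) :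
    ∃ c : Y → ℕ, ∑ y, c y = N ∧ (∀ y, v y = 0 → c y = 0) ∧
      ∀ y, |(c y : ℝ) - N * v y| ≤ Fintype.card Y := by
  -- All counts are rounded down except at y₀, which takes up the deficit; since v y₀ > 0, zeros of
  -- v keep count zero.
  obtain ⟨y₀, hy₀⟩ : ∃ y, 0 < v y := by
    by_contra! hcon
    have := Finset.sum_nonpos fun y (_ : y ∈ Finset.univ) => hcon y
    linarith [hv.2]
  have hnn : ∀ y, 0 ≤ N * v y := fun y => mul_nonneg N.cast_nonneg (hv.1 y)
  have hsum : ∑ y ∈ Finset.univ.erase y₀, N * v y = N - N * v y₀ := by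
    have := Finset.add_sum_erase Finset.univ (fun y => N * v y) (Finset.mem_univ y₀)
    have h1 : ∑ y, N * v y = N := by rw [← Finset.mul_sum, hv.2, mul_one]
    linarith
  set S := ∑ y ∈ Finset.univ.erase y₀, ⌊N * v y⌋₊ with hS
  have hSR : (S : ℝ) = ∑ y ∈ Finset.univ.erase y₀, (⌊N * v y⌋₊ : ℝ) := by
    rw [hS, Nat.cast_sum]
  have hS1 : (S : ℝ) ≤ N - N * v y₀ := by
    rw [hSR, ← hsum]
    exact Finset.sum_le_sum fun y _ => Nat.floor_le (hnn y)
  have hS2 : N - N * v y₀ ≤ S + Fintype.card Y := by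
    have h1 : ∑ y ∈ Finset.univ.erase y₀, N * v y ≤
        ∑ y ∈ Finset.univ.erase y₀, ((⌊N * v y⌋₊ : ℝ) + 1) :=
      Finset.sum_le_sum fun y _ => (Nat.lt_floor_add_one _).le
    rw [Finset.sum_add_distrib, ← hSR, hsum] at h1
    have h2 : ∑ y ∈ Finset.univ.erase y₀, (1 : ℝ) ≤ Fintype.card Y := by
      rw [Finset.sum_const, nsmul_eq_mul, mul_one]
      exact_mod_cast Finset.card_le_univ _
    linarith
  have hSN : S ≤ N := by
    have : (S : ℝ) ≤ N := hS1.trans (by linarith [hnn y₀])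
    exact_mod_cast this
  refine ⟨fun y => if y = y₀ then N - S else ⌊N * v y⌋₊, ?_, fun y hy => ?_, fun y => ?_⟩
  · rw [← Finset.add_sum_erase _ _ (Finset.mem_univ y₀), if_pos rfl,
      Finset.sum_congr rfl (g := fun y => ⌊N * v y⌋₊), ← hS]
    · omega
    · intro y hy
      rw [if_neg (Finset.ne_of_mem_erase hy)]
  · have : y ≠ y₀ := fun h => hy₀.ne' (h ▸ hy)
    simp [this, hy]
  · have hY : (1 : ℝ) ≤ Fintype.card Y := by
      exact_mod_cast Fintype.card_pos_iff.2 ⟨y₀⟩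
    dsimp only
    split_ifs with h
    · rw [h, Nat.cast_sub hSN, abs_le]
      constructor <;> linarith
    · rw [abs_le]
      have h1 := Nat.floor_le (hnn y)
      have h2 := Nat.lt_floor_add_one (N * v y)
      constructor <;> linarith

variable [DecidableEq X] [DecidableEq Y]

/-- Each row of V is rounded with total equal to the count of its letter. The first marginal is thus
exact, and zeros of V persist, which will give `Compat`. -/
lemma exists_jointType {n : ℕ} (hn : 0 < n) {Q' : X → ℝ} (hQ' : (typeClass n Q').Nonempty)
    {V : X → Y → ℝ} (hV : IsChannel V) :
    ∃ P ∈ jointTypes n Q' Y, (∀ x y, V x y = 0 → P (x, y) = 0) ∧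
      ∀ p, |P p - joint Q' V p| ≤ Fintype.card Y / n := by
  obtain ⟨x₀, hx₀⟩ := hQ'
  rw [mem_typeClass] at hx₀
  subst hx₀
  have hn' : (0 : ℝ) < n := by exact_mod_cast hn
  choose c hc1 hc2 hc3 using fun x => exists_counts (cnt x₀ x) (hV x)
  obtain ⟨z, hz⟩ := exists_cnt_eq (n := n) (fun p : X × Y => c p.1 p.2) (by
    rw [Fintype.sum_prod_type]
    simp [hc1, sum_cnt])
  have hP : ∀ p, empDist z p = (c p.1 p.2 : ℝ) / n := fun p => by rw [empDist_apply, hz]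
  refine ⟨empDist z, mem_jointTypes.2 ⟨mem_types.2 ⟨z, rfl⟩, ?_⟩, fun x y hxy => ?_, fun p => ?_⟩
  · ext x
    simp only [margX, hP]
    rw [← Finset.sum_div, ← Nat.cast_sum, hc1, empDist_apply]
  · rw [hP, hc2 x y hxy]
    simp
  · have h1 : (c p.1 p.2 : ℝ) / n - cnt x₀ p.1 / n * V p.1 p.2 =
        ((c p.1 p.2 : ℝ) - cnt x₀ p.1 * V p.1 p.2) / n := by
      ring
    rw [hP, joint, empDist_apply, h1, abs_div, abs_of_pos hn']
    exact div_le_div_of_nonneg_right (hc3 _ _) hn'.le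

/-- Every coupling is a limit of joint types. -/
lemma eventually_exists_jointType (hW : IsChannel W) {n : ℕ → ℕ} (hn : Tendsto n atTop atTop)
    {Qs : ℕ → X → ℝ} (hQs : ∀ k, (typeClass (n k) (Qs k)).Nonempty)
    (hQlim : Tendsto Qs atTop (𝓝 Q)) {P₀ : X × Y → ℝ} (hP₀ : P₀ ∈ coupl W Q)
    {h : (X × Y → ℝ) → ℝ} (hh : Continuous h) {ε : ℝ} (hε : 0 < ε) :
    ∀ᶠ k in atTop, ∃ P ∈ jointTypes (n k) (Qs k) Y, Compat W P ∧ h P ≤ h P₀ + ε := by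
  obtain ⟨V, hV, rfl⟩ := exists_joint_eq hW hP₀
  have hpos : ∀ᶠ k in atTop, 0 < n k := hn.eventually_gt_atTop 0
  -- Only positive block lengths matter; the value chosen elsewhere is arbitrary.
  have hex : ∀ k, ∃ P : X × Y → ℝ, 0 < n k → P ∈ jointTypes (n k) (Qs k) Y ∧
      (∀ x y, V x y = 0 → P (x, y) = 0) ∧
      ∀ p, |P p - joint (Qs k) V p| ≤ Fintype.card Y / n k := by
    intro k
    by_cases hk : 0 < n k
    · obtain ⟨P, hP⟩ := exists_jointType hk (hQs k) hV.1
      exact ⟨P, fun _ => hP⟩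
    · exact ⟨0, fun h => absurd h hk⟩
  choose P hP using hex
  have hlim : Tendsto P atTop (𝓝 (joint Q V)) := by
    rw [tendsto_pi_nhds]
    intro p
    have h1 : Tendsto (fun k => joint (Qs k) V p) atTop (𝓝 (joint Q V p)) :=
      ((continuous_apply p.1).tendsto Q |>.comp hQlim).mul_const _
    have h2 : Tendsto (fun k => (Fintype.card Y : ℝ) / n k) atTop (𝓝 0) :=
      (tendsto_natCast_atTop_atTop.comp hn).const_div_atTop _
    have h3 : Tendsto (fun k => P k p - joint (Qs k) V p) atTop (𝓝 0) := by
      refine squeeze_zero_norm' ?_ h2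
      filter_upwards [hpos] with k hk
      exact (hP k hk).2.2 p
    have h4 := h3.add h1
    simpa using h4
  have hev := (hh.tendsto _ |>.comp hlim).eventually (ge_mem_nhds (lt_add_of_pos_right _ hε))
  filter_upwards [hpos, hev] with k hk hk2
  exact ⟨P k, (hP k hk).1, fun p hp => (hP k hk).2.1 _ _ (hV.2 _ _ hp), hk2⟩

end Couplings

/-! ### From extended-real objectives on channels to real functions of couplings -/

section Objectives

variable {X Y : Type*} [Fintype X] [Fintype Y] {W : X → Y → ℝ} {Q : X → ℝ}

lemma inputChannelInfo_eq (hQ : ∀ x, 0 ≤ Q x) {V : X → Y → ℝ} (hV : IsChannel V) :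
    inputChannelInfo Q V = jointInfo (joint Q V) :=
  mutualInfo_eq_jointInfo fun _ => mul_nonneg (hQ _) ((hV _).1 _)

lemma jointDiv_joint (hQ : ∀ x, 0 ≤ Q x) {V : X → Y → ℝ} (hV : IsChannel V)
    (h : ∀ x y, 0 < Q x → W x y = 0 → V x y = 0) :
    ∑ x, Q x * ∑ y, V x y * Real.log (V x y / W x y) = jointDiv W (joint Q V) := by
  have h1 : ∀ x y, Q x * (V x y * Real.log (V x y / W x y)) =
      -Real.negMulLog (joint Q V (x, y)) - Q x * Real.log (Q x) * V x y -
        joint Q V (x, y) * Real.log (W x y) := by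
    intro x y
    simp only [joint]
    rcases eq_or_lt_of_le (hQ x) with h0 | h0
    · simp [← h0]
    rcases eq_or_lt_of_le ((hV x).1 y) with h2 | h2
    · simp [← h2]
    have h3 : W x y ≠ 0 := fun hw => h2.ne' (h x y h0 hw)
    rw [Real.log_div h2.ne' h3, Real.negMulLog, Real.log_mul h0.ne' h2.ne']
    ring
  simp only [Finset.mul_sum, h1, Finset.sum_sub_distrib, Finset.sum_neg_distrib]
  simp only [← Finset.mul_sum, (hV _).2, mul_one]
  rw [jointDiv, margX_joint hV, ent, ent, Fintype.sum_prod_type, Fintype.sum_prod_type]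
  simp only [Real.negMulLog, neg_mul, Finset.sum_neg_distrib]
  ring

lemma condDiv_eq (hQ : ∀ x, 0 ≤ Q x) {V : X → Y → ℝ} (hV : IsChannel V)
    (h : ∀ x y, 0 < Q x → W x y = 0 → V x y = 0) :
    condDiv V W Q = (jointDiv W (joint Q V) : EReal) := by
  rw [condDiv, if_pos h, jointDiv_joint hQ hV h]

/-- Minimizing over channels amounts to minimizing over couplings. -/
lemma isLeast_image_channels (hW : IsChannel W) (hQ : ∀ x, 0 ≤ Q x) {F : (X → Y → ℝ) → EReal}
    {f : (X × Y → ℝ) → ℝ}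
    (hF : ∀ V, IsChannel V → (∀ x y, 0 < Q x → W x y = 0 → V x y = 0) → F V = f (joint Q V))
    (hF' : ∀ V, ¬ (∀ x y, 0 < Q x → W x y = 0 → V x y = 0) → F V = ⊤)
    {P₀ : X × Y → ℝ} (hP₀ : P₀ ∈ coupl W Q) (hmin : ∀ P ∈ coupl W Q, f P₀ ≤ f P) :
    IsLeast (F '' channels X Y) (f P₀ : EReal) := by
  constructor
  · obtain ⟨V, hV, rfl⟩ := exists_joint_eq hW hP₀
    exact ⟨V, hV.1, hF V hV.1 fun x y _ h => hV.2 x y h⟩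
  · rintro _ ⟨V, hV, rfl⟩
    by_cases h : ∀ x y, 0 < Q x → W x y = 0 → V x y = 0
    · rw [hF V hV h]
      exact EReal.coe_le_coe_iff.2 (hmin _ (joint_mem_coupl hQ hV h))
    · rw [hF' V h]
      exact le_top

lemma listObjective_eq (hQ : ∀ x, 0 ≤ Q x) (R : ℝ) (L : ℕ) {V : X → Y → ℝ}
    (hV : IsChannel V) (h : ∀ x y, 0 < Q x → W x y = 0 → V x y = 0) :
    listObjective W Q R L V = (listExp W R L (joint Q V) : EReal) := by
  rw [listObjective, condDiv_eq hQ hV h, inputChannelInfo_eq hQ hV, listExp, EReal.coe_add]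

lemma rhoObjective_eq (hQ : ∀ x, 0 ≤ Q x) (R ρ : ℝ) {V : X → Y → ℝ}
    (hV : IsChannel V) (h : ∀ x y, 0 < Q x → W x y = 0 → V x y = 0) :
    rhoObjective W Q R ρ V = (rhoExp W R ρ (joint Q V) : EReal) := by
  rw [rhoObjective, condDiv_eq hQ hV h, inputChannelInfo_eq hQ hV, rhoExp, EReal.coe_add]

lemma listObjective_eq_top (R : ℝ) (L : ℕ) {V : X → Y → ℝ}
    (h : ¬ ∀ x y, 0 < Q x → W x y = 0 → V x y = 0) : listObjective W Q R L V = ⊤ := by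
  rw [listObjective, condDiv, if_neg h, EReal.top_add_coe]

lemma rhoObjective_eq_top (R ρ : ℝ) {V : X → Y → ℝ}
    (h : ¬ ∀ x y, 0 < Q x → W x y = 0 → V x y = 0) : rhoObjective W Q R ρ V = ⊤ := by
  rw [rhoObjective, condDiv, if_neg h, EReal.top_add_coe]

/-- The maximum over `ρ` of `D + ρ (I - R)` is `D + L [I - R]₊`. -/
lemma isGreatest_rhoObjective (hQ : ∀ x, 0 ≤ Q x) (R : ℝ) (L : ℕ)
    {V : X → Y → ℝ} (hV : IsChannel V) :
    IsGreatest ((fun ρ : ℝ => rhoObjective W Q R ρ V) '' Set.Icc (0 : ℝ) L)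
      (listObjective W Q R L V) := by
  by_cases h : ∀ x y, 0 < Q x → W x y = 0 → V x y = 0
  · rw [listObjective_eq hQ R L hV h]
    constructor
    · obtain ⟨ρ, hρ, hρe⟩ := exists_rhoExp_eq_listExp (W := W) R L (joint Q V)
      exact ⟨ρ, hρ, by simp only [rhoObjective_eq hQ R ρ hV h, hρe]⟩
    · rintro _ ⟨ρ, hρ, rfl⟩
      simp only [rhoObjective_eq hQ R ρ hV h]
      exact EReal.coe_le_coe_iff.2 (rhoExp_le_listExp hρ.1 hρ.2 _)
  · rw [listObjective_eq_top R L h]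
    exact ⟨⟨0, ⟨le_rfl, L.cast_nonneg⟩, rhoObjective_eq_top R 0 h⟩, fun _ _ => le_top⟩

end Objectives

/-! ### Exponential bounds for the contribution of one joint type -/

section Exponents

variable {X Y : Type*} [Fintype X] [Fintype Y] [DecidableEq X] [DecidableEq Y]
  {W : X → Y → ℝ} {n M L : ℕ} {R : ℝ} {Q : X → ℝ}

lemma exp_le_numMessages (R : ℝ) (n : ℕ) : Real.exp (n * R) ≤ numMessages R n := by
  unfold numMessages
  push_cast
  exact (Nat.lt_floor_add_one _).le

lemma numMessages_le (hR : 0 ≤ R) (n : ℕ) :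
    (numMessages R n : ℝ) ≤ Real.exp (n * R + slack n) := by
  have h1 : 1 ≤ Real.exp (n * R) := Real.one_le_exp (by positivity)
  have h2 := Nat.floor_le (Real.exp_pos (n * R)).le
  -- The extra message at most doubles exp(nR) ≥ 1, and this factor is absorbed in the slack.
  have h3 : (2 : ℝ) ≤ Real.exp (slack n) := by
    have := Real.add_one_le_exp (slack n)
    linarith [one_le_slack n]
  unfold numMessages
  push_cast
  rw [Real.exp_add]
  nlinarith

lemma mem_coupl_of_mem_jointTypes {P : X × Y → ℝ} (hP : P ∈ jointTypes n Q Y)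
    (hc : Compat W P) : P ∈ coupl W Q := by
  obtain ⟨h1, h2⟩ := mem_jointTypes.1 hP
  obtain ⟨z, rfl⟩ := mem_types.1 h1
  exact ⟨empDist_nonneg z, h2, hc⟩

/-- Truncation at one turns the exponent I - R into its positive part, since min(1, exp(-nt)) =
exp(-n[t]₊). -/
lemma le_typeMass_mul_min (hn : 0 < n) {P : X × Y → ℝ} (hP : P ∈ types n (X × Y))
    (hc : Compat W P) (hM : Real.exp (n * R) ≤ M) :
    Real.exp (-(n * listExp W R L P) - (1 + L) * (Fintype.card (X × Y) * slack n)) ≤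
      typeMass W n P * (min 1 (M * hitProb n P)) ^ L := by
  have hs : 0 ≤ Fintype.card (X × Y) * slack n := mul_nonneg (Nat.cast_nonneg _) (slack_nonneg n)
  have hn0 : (0 : ℝ) ≤ n := n.cast_nonneg
  have h1 : Real.exp (-(n * max 0 (jointInfo P - R)) - Fintype.card (X × Y) * slack n) ≤
      min 1 (M * hitProb n P) := by
    refine le_min (Real.exp_le_one_iff.2 ?_) ?_
    · have : 0 ≤ n * max 0 (jointInfo P - R) := mul_nonneg hn0 (le_max_left _ _)
      linarith
    · refine le_trans ?_ (mul_le_mul hM (le_hitProb hn hP) (Real.exp_pos _).le M.cast_nonneg)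
      rw [← Real.exp_add]
      refine Real.exp_le_exp.2 ?_
      have := mul_le_mul_of_nonneg_left (le_max_right 0 (jointInfo P - R)) hn0
      linarith
  have h2 := pow_le_pow_left₀ (Real.exp_pos _).le h1 L
  rw [← Real.exp_nat_mul] at h2
  refine le_trans (le_of_eq ?_) (mul_le_mul (le_typeMass hn hP hc) h2 (Real.exp_pos _).le
    (typeMass_nonneg W P))
  rw [← Real.exp_add, listExp]
  congr 1
  ring

lemma typeMass_mul_min_le (hn : 0 < n) {P : X × Y → ℝ} (hP : P ∈ types n (X × Y))
    (hc : Compat W P) {c : ℝ} (hc0 : 0 ≤ c) (hM : (M : ℝ) ≤ Real.exp (n * R + slack n)) :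
    typeMass W n P * (min 1 (M * Real.exp (-(n * jointInfo P) + c * slack n))) ^ L ≤
      Real.exp (-(n * listExp W R L P) + (Fintype.card X + L * (c + 1)) * slack n) := by
  have hs : 0 ≤ (c + 1) * slack n := mul_nonneg (by linarith) (slack_nonneg n)
  have h1 : min 1 (M * Real.exp (-(n * jointInfo P) + c * slack n)) ≤
      Real.exp (-(n * max 0 (jointInfo P - R)) + (c + 1) * slack n) := by
    rcases le_total (jointInfo P - R) 0 with h | h
    · rw [max_eq_left h]
      exact (min_le_left _ _).trans (Real.one_le_exp (by linarith))
    · rw [max_eq_right h]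
      refine (min_le_right _ _).trans ((mul_le_mul_of_nonneg_right hM (Real.exp_pos _).le).trans ?_)
      rw [← Real.exp_add]
      refine Real.exp_le_exp.2 ?_
      linarith
  have h2 := pow_le_pow_left₀ (le_min zero_le_one (by positivity)) h1 L
  rw [← Real.exp_nat_mul] at h2
  refine (mul_le_mul (typeMass_le hn hP hc) h2 (pow_nonneg (le_min zero_le_one (by positivity)) _)
    (Real.exp_pos _).le).trans (le_of_eq ?_)
  rw [← Real.exp_add, listExp]
  congr 1
  ring

lemma typeMass_mul_rpow_le (hn : 0 < n) {P : X × Y → ℝ} (hP : P ∈ types n (X × Y))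
    (hc : Compat W P) {ρ : ℝ} (hρ : 0 ≤ ρ) (hM : (M : ℝ) ≤ Real.exp (n * R + slack n)) :
    typeMass W n P * (M * hitProb n P) ^ ρ ≤
      Real.exp (-(n * rhoExp W R ρ P) +
        (Fintype.card X + ρ * (Fintype.card X + Fintype.card Y + 1)) * slack n) := by
  have h0 : 0 ≤ M * hitProb n P := mul_nonneg M.cast_nonneg (hitProb_nonneg P)
  have h1 := Real.rpow_le_rpow h0
    (mul_le_mul hM (hitProb_le hn hP) (hitProb_nonneg P) (Real.exp_pos _).le) hρ
  rw [← Real.exp_add, ← Real.exp_mul] at h1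
  refine (mul_le_mul (typeMass_le hn hP hc) h1 (Real.rpow_nonneg h0 _)
    (Real.exp_pos _).le).trans (le_of_eq ?_)
  rw [← Real.exp_add, rhoExp]
  congr 1
  ring

lemma sum_jointTypes_le {F : (X × Y → ℝ) → ℝ} {t : ℝ}
    (hF : ∀ P ∈ jointTypes n Q Y, Compat W P → F P ≤ Real.exp t)
    (hF' : ∀ P ∈ jointTypes n Q Y, ¬ Compat W P → F P = 0) :
    ∑ P ∈ jointTypes n Q Y, F P ≤ Real.exp (t + Fintype.card (X × Y) * slack n) := by
  refine (Finset.sum_le_card_nsmul _ _ (Real.exp t) fun P hP => ?_).trans ?_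
  · by_cases hc : Compat W P
    · exact hF P hP hc
    · rw [hF' P hP hc]
      exact (Real.exp_pos _).le
  · rw [nsmul_eq_mul, add_comm, Real.exp_add]
    exact mul_le_mul_of_nonneg_right (card_jointTypes_le Q) (Real.exp_pos _).le

end Exponents

/-! ### Absorbing subexponential factors -/

section Asymptotics

lemma tendsto_slack_div : Tendsto (fun n : ℕ => slack n / n) atTop (𝓝 0) := by
  have h1 : Tendsto (fun n : ℕ => Real.log ((n : ℝ) + 1) / ((n : ℝ) + 1)) atTop (𝓝 0) := by
    have := Real.isLittleO_log_id_atTop.tendsto_div_nhds_zero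
    exact this.comp (tendsto_atTop_add_const_right _ 1 tendsto_natCast_atTop_atTop)
  have h2 : Tendsto (fun n : ℕ => (1 : ℝ) / n) atTop (𝓝 0) :=
    tendsto_const_div_atTop_nhds_zero_nat 1
  have h3 : Tendsto (fun n : ℕ => 1 / (n : ℝ) +
      2 * (Real.log ((n : ℝ) + 1) / ((n : ℝ) + 1)) * (1 + 1 / n)) atTop (𝓝 0) := by
    have := h2.add ((h1.const_mul 2).mul (h2.const_add 1))
    simpa using this
  refine h3.congr' ?_
  filter_upwards [eventually_gt_atTop 0] with n hn
  have hn' : (0 : ℝ) < n := by exact_mod_cast hn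
  unfold slack
  field_simp

lemma eventually_mul_slack_le {n : ℕ → ℕ} (hn : Tendsto n atTop atTop) (c d : ℝ) {ε : ℝ}
    (hε : 0 < ε) : ∀ᶠ k in atTop, c * slack (n k) + d ≤ n k * ε := by
  have h1 : Tendsto (fun m : ℕ => c * (slack m / m) + d / m) atTop (𝓝 0) := by
    have := (tendsto_slack_div.const_mul c).add (tendsto_const_div_atTop_nhds_zero_nat d)
    simpa using this
  have h2 := (h1.comp hn).eventually (ge_mem_nhds hε)
  filter_upwards [h2, hn.eventually_gt_atTop 0] with k hk hpos
  have hpos' : (0 : ℝ) < n k := by exact_mod_cast hpos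
  have h3 := mul_le_mul_of_nonneg_left hk hpos'.le
  refine le_trans (le_of_eq ?_) h3
  simp only [Function.comp]
  field_simp

lemma expEq_exp_of_eventually {n : ℕ → ℕ} (hn : Tendsto n atTop atTop) {a : ℕ → ℝ} {E : ℝ}
    (hl : ∀ ε : ℝ, 0 < ε → ∀ᶠ k in atTop, Real.exp (-(n k * (E + ε))) ≤ a k)
    (hu : ∀ ε : ℝ, 0 < ε → ∀ᶠ k in atTop, a k ≤ Real.exp (-(n k * (E - ε)))) :
    ExpEq n a (fun k => Real.exp (-(n k * E))) := by
  have hpos : ∀ᶠ k in atTop, 0 < a k := by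
    filter_upwards [hl 1 one_pos] with k hk
    exact (Real.exp_pos _).trans_le hk
  refine ⟨hpos, Eventually.of_forall fun k => Real.exp_pos _, ?_⟩
  rw [Metric.tendsto_nhds]
  intro ε hε
  filter_upwards [hpos, hl (ε / 2) (by linarith), hu (ε / 2) (by linarith),
    hn.eventually_gt_atTop 0] with k hk h1 h2 hn0
  have hn' : (0 : ℝ) < n k := by exact_mod_cast hn0
  have h1' := Real.log_le_log (Real.exp_pos _) h1
  have h2' := Real.log_le_log hk h2
  rw [Real.log_exp] at h1' h2'
  rw [Real.dist_eq, sub_zero, Real.log_div hk.ne' (Real.exp_pos _).ne', Real.log_exp]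
  refine lt_of_le_of_lt (b := ε / 2) (abs_le.2 ⟨?_, ?_⟩) (by linarith)
  · rw [one_div, le_inv_mul_iff₀ hn']
    linarith
  · rw [one_div, inv_mul_le_iff₀ hn']
    linarith

lemma eventually_mul_le_numMessages {n : ℕ → ℕ} (hn : Tendsto n atTop atTop) {R : ℝ} (hR : 0 < R)
    (m : ℕ) : ∀ᶠ k in atTop, m ≤ numMessages R (n k) := by
  have h1 : Tendsto (fun k => (n k : ℝ) * R) atTop atTop :=
    (tendsto_natCast_atTop_atTop.comp hn).atTop_mul_const hR
  filter_upwards [(Real.tendsto_exp_atTop.comp h1).eventually_ge_atTop (m : ℝ)] with k hk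
  exact_mod_cast hk.trans (exp_le_numMessages R (n k))

end Asymptotics

/-! ### Asymptotic bounds along the block lengths -/

section Main

variable {X Y : Type*} [Fintype X] [Fintype Y] [DecidableEq X] [DecidableEq Y]
  {W : X → Y → ℝ} {R : ℝ} {L : ℕ} {Q : X → ℝ} {n : ℕ → ℕ} {Qs : ℕ → X → ℝ}

/-- Eventually some joint type witnesses the exponent of an optimal coupling. -/
lemma eventually_exists_le_typeMass_mul_min (hW : IsChannel W)
    (hn : Tendsto n atTop atTop) (hQs : ∀ k, (typeClass (n k) (Qs k)).Nonempty)
    (hQlim : Tendsto Qs atTop (𝓝 Q)) {P₀ : X × Y → ℝ} (hP₀ : P₀ ∈ coupl W Q)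
    {c : ℝ} (hc : 0 < c) {ε : ℝ} (hε : 0 < ε) :
    ∀ᶠ k in atTop, ∃ P ∈ jointTypes (n k) (Qs k) Y,
      Real.exp (-(n k * (listExp W R L P₀ + ε))) ≤ c * (typeMass W (n k) P *
        (min 1 (numMessages R (n k) * hitProb (n k) P)) ^ L) := by
  filter_upwards [eventually_exists_jointType hW hn hQs hQlim hP₀
      (continuous_listExp W R L) (half_pos hε),
    eventually_mul_slack_le hn ((1 + L) * Fintype.card (X × Y)) (-Real.log c) (half_pos hε),
    hn.eventually_gt_atTop 0] with k ⟨P, hP, hPc, hPh⟩ hs hpos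
  refine ⟨P, hP, ?_⟩
  refine le_trans ?_ (mul_le_mul_of_nonneg_left (le_typeMass_mul_min hpos (jointTypes_subset _ hP)
    hPc (exp_le_numMessages R (n k))) hc.le)
  nth_rewrite 1 [← Real.exp_log hc]
  rw [← Real.exp_add]
  refine Real.exp_le_exp.2 ?_
  have := mul_le_mul_of_nonneg_left hPh (Nat.cast_nonneg (α := ℝ) (n k))
  linarith

lemma eventually_le_avgListError (hW : IsChannel W) (hR : 0 < R) (hL : 1 ≤ L)
    (hn : Tendsto n atTop atTop) (hQs : ∀ k, (typeClass (n k) (Qs k)).Nonempty)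
    (hQlim : Tendsto Qs atTop (𝓝 Q)) {P₀ : X × Y → ℝ} (hP₀ : P₀ ∈ coupl W Q)
    {ε : ℝ} (hε : 0 < ε) :
    ∀ᶠ k in atTop, ∀ g : ListDecoder X Y (n k) (numMessages R (n k)), HasListSize L g →
      Real.exp (-(n k * (listExp W R L P₀ + ε))) ≤
        avgListError W (uniformTypeClass (n k) (Qs k)) g := by
  filter_upwards [eventually_exists_le_typeMass_mul_min (R := R) (L := L) hW hn hQs hQlim hP₀
    (surplusConst_pos L) hε, eventually_mul_le_numMessages hn hR (4 * L)] with
    k ⟨P, hP, hk⟩ hM g hg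
  exact hk.trans (le_avgListError hW hL hM (hQs k) hg hP)

omit [DecidableEq X] [DecidableEq Y] in
lemma gallagerBound_eq {m M : ℕ} (U : (Fin m → X) → ℝ) :
    gallagerBound W U M L = sInf (gallagerFun W U M '' Set.Icc (0 : ℝ) L) := rfl

lemma eventually_le_gallagerBound (hW : IsChannel W)
    (hn : Tendsto n atTop atTop) (hQs : ∀ k, (typeClass (n k) (Qs k)).Nonempty)
    (hQlim : Tendsto Qs atTop (𝓝 Q)) {P₀ : X × Y → ℝ} (hP₀ : P₀ ∈ coupl W Q)
    {ε : ℝ} (hε : 0 < ε) :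
    ∀ᶠ k in atTop, Real.exp (-(n k * (listExp W R L P₀ + ε))) ≤
      gallagerBound W (uniformTypeClass (n k) (Qs k)) (numMessages R (n k)) L := by
  filter_upwards [eventually_exists_le_typeMass_mul_min (R := R) (L := L) hW hn hQs hQlim hP₀
    one_pos hε] with k ⟨P, hP, hk⟩
  rw [one_mul] at hk
  rw [gallagerBound_eq]
  refine le_csInf ⟨_, 0, ⟨le_rfl, L.cast_nonneg⟩, rfl⟩ ?_
  rintro _ ⟨ρ, hρ, rfl⟩
  exact hk.trans (le_gallagerFun hW hP hρ.1 hρ.2)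

lemma eventually_avgListError_le (hW : IsChannel W) (hR : 0 < R) (hQ : ∀ x, 0 ≤ Q x)
    (hn : Tendsto n atTop atTop) (hQs : ∀ k, (typeClass (n k) (Qs k)).Nonempty)
    (hQlim : Tendsto Qs atTop (𝓝 Q)) {E : ℝ} (hE : ∀ P ∈ coupl W Q, E ≤ listExp W R L P)
    {ε : ℝ} (hε : 0 < ε) :
    ∀ᶠ k in atTop, ∀ g : ListDecoder X Y (n k) (numMessages R (n k)), IsMMIListDecoder L g →
      avgListError W (uniformTypeClass (n k) (Qs k)) g ≤ Real.exp (-(n k * (E - ε))) := by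
  set c : ℝ := Fintype.card X + Fintype.card Y + Fintype.card (X × Y) with hc
  have hc0 : 0 ≤ c := by positivity
  filter_upwards [hQlim.eventually (eventually_forall_coupl_le hW hQ (continuous_listExp W R L)
      (half_pos hε) hE),
    eventually_mul_slack_le hn (Fintype.card X + L * (c + 1) + Fintype.card (X × Y)) 0
      (half_pos hε), hn.eventually_gt_atTop 0] with k hk hs hpos g hg
  refine (hg.avgListError_le hW hpos (Nat.succ_pos _) (hQs k)).trans ?_
  rw [← hc]
  refine (sum_jointTypes_le (W := W) (t := -(n k * (E - ε / 2)) +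
    (Fintype.card X + L * (c + 1)) * slack (n k)) (fun P hP hPc => ?_) fun P _ hPc => ?_).trans ?_
  · refine (typeMass_mul_min_le hpos (jointTypes_subset _ hP) hPc hc0
      (numMessages_le hR.le (n k))).trans (Real.exp_le_exp.2 ?_)
    have := mul_le_mul_of_nonneg_left (hk P (mem_coupl_of_mem_jointTypes hP hPc))
      (Nat.cast_nonneg (α := ℝ) (n k))
    linarith
  · rw [typeMass_eq_zero hPc, zero_mul]
  · refine Real.exp_le_exp.2 ?_
    linarith

omit [DecidableEq Y] in
lemma gallagerFun_nonneg (hW : IsChannel W) {m M : ℕ} (Q' : X → ℝ) (ρ : ℝ) :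
    0 ≤ gallagerFun (n := m) W (uniformTypeClass m Q') M ρ := by
  refine mul_nonneg (Real.rpow_nonneg M.cast_nonneg _) (Finset.sum_nonneg fun y _ =>
    Real.rpow_nonneg (Finset.sum_nonneg fun x _ => mul_nonneg (uniformTypeClass_nonneg Q' x)
      (Real.rpow_nonneg (seqProb_nonneg hW x y) _)) _)

/-- One fixed ρ suffices to bound the infimum, so no uniformity in ρ is needed. The theorem takes ρ
from the saddle point, where D + ρ(I-R) is at least the optimal exponent on all couplings. -/
lemma eventually_gallagerBound_le (hW : IsChannel W) (hR : 0 < R) (hQ : ∀ x, 0 ≤ Q x)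
    (hn : Tendsto n atTop atTop) (hQlim : Tendsto Qs atTop (𝓝 Q)) {E ρ : ℝ}
    (hρ : ρ ∈ Set.Icc (0 : ℝ) L) (hE : ∀ P ∈ coupl W Q, E ≤ rhoExp W R ρ P)
    {ε : ℝ} (hε : 0 < ε) :
    ∀ᶠ k in atTop, gallagerBound W (uniformTypeClass (n k) (Qs k)) (numMessages R (n k)) L ≤
      Real.exp (-(n k * (E - ε))) := by
  set c : ℝ := Fintype.card X + ρ * (Fintype.card X + Fintype.card Y + 1) with hc
  filter_upwards [hQlim.eventually (eventually_forall_coupl_le hW hQ (continuous_rhoExp W R ρ)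
      (half_pos hε) hE),
    eventually_mul_slack_le hn (c + Fintype.card (X × Y) + ρ * Fintype.card (X × Y)) 0
      (half_pos hε), hn.eventually_gt_atTop 0] with k hk hs hpos
  rw [gallagerBound_eq]
  have hbdd : BddBelow (gallagerFun W (uniformTypeClass (n k) (Qs k)) (numMessages R (n k)) ''
      Set.Icc (0 : ℝ) L) := by
    refine ⟨0, ?_⟩
    rintro _ ⟨ρ', _, rfl⟩
    exact gallagerFun_nonneg hW _ _
  refine (csInf_le hbdd ⟨ρ, hρ, rfl⟩).trans ((gallagerFun_le hW _ hρ.1).trans ?_)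
  have h1 : ((jointTypes (n k) (Qs k) Y).card : ℝ) ^ ρ ≤
      Real.exp (ρ * Fintype.card (X × Y) * slack (n k)) := by
    refine (Real.rpow_le_rpow (Nat.cast_nonneg _) (card_jointTypes_le (Qs k)) hρ.1).trans ?_
    rw [← Real.exp_mul]
    exact le_of_eq (congrArg _ (by ring))
  have h2 : ∑ P ∈ jointTypes (n k) (Qs k) Y,
      typeMass W (n k) P * (numMessages R (n k) * hitProb (n k) P) ^ ρ ≤
      Real.exp (-(n k * (E - ε / 2)) + c * slack (n k) + Fintype.card (X × Y) * slack (n k)) := by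
    refine sum_jointTypes_le (W := W) (fun P hP hPc => ?_) fun P _ hPc => ?_
    · refine (typeMass_mul_rpow_le hpos (jointTypes_subset _ hP) hPc hρ.1
        (numMessages_le hR.le (n k))).trans (Real.exp_le_exp.2 ?_)
      have := mul_le_mul_of_nonneg_left (hk P (mem_coupl_of_mem_jointTypes hP hPc))
        (Nat.cast_nonneg (α := ℝ) (n k))
      linarith
    · rw [typeMass_eq_zero hPc, zero_mul]
  refine (mul_le_mul h1 h2 (Finset.sum_nonneg fun P _ => mul_nonneg (typeMass_nonneg W P)
    (Real.rpow_nonneg (mul_nonneg (Nat.cast_nonneg _) (hitProb_nonneg P)) _))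
    (Real.exp_pos _).le).trans ?_
  rw [← Real.exp_add]
  refine Real.exp_le_exp.2 ?_
  linarith

end Main

end ListDecoding

open ListDecoding in
/-- Block lengths `n k → ∞` and types `Qs k` of sequences of length `n k` with `Qs k → Q`; the
choice `Qs k = Q` is the case of one fixed type `Q`. -/
theorem mainTheorem2 {X Y : Type*} [Fintype X] [Fintype Y] [DecidableEq X] [DecidableEq Y]
    (W : X → Y → ℝ) (hW : IsChannel W)
    (R : ℝ) (hR : 0 < R) (L : ℕ) (hL : 1 ≤ L)
    (Q : X → ℝ) (hQ : Q ∈ stdSimplex ℝ X)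
    (n : ℕ → ℕ) (hn : Tendsto n atTop atTop)
    (Qs : ℕ → X → ℝ) (hQs : ∀ k, (typeClass (n k) (Qs k)).Nonempty)
    (hQlim : Tendsto Qs atTop (𝓝 Q)) :
    ∃ E : ℝ,
      -- `E = min_V {D(V‖W|Q) + L [I(X;Y) - R]₊}`
      IsLeast (listObjective W Q R L '' channels X Y) (E : EReal) ∧
      -- the exact exponent of the maximum likelihood list decoder
      (∀ g : (k : ℕ) → ListDecoder X Y (n k) (numMessages R (n k)),
        (∀ᶠ k in atTop, IsMLListDecoder W L (g k)) →
        ExpEq n (fun k => avgListError W (uniformTypeClass (n k) (Qs k)) (g k))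
          (fun k => Real.exp (-(n k * E)))) ∧
      -- the maximum mutual information list decoder has the same exponent
      (∀ g : (k : ℕ) → ListDecoder X Y (n k) (numMessages R (n k)),
        (∀ᶠ k in atTop, IsMMIListDecoder L (g k)) →
        ExpEq n (fun k => avgListError W (uniformTypeClass (n k) (Qs k)) (g k))
          (fun k => Real.exp (-(n k * E)))) ∧
      -- no list decoder has a better exponent
      (∀ ε : ℝ, 0 < ε → ∀ᶠ k in atTop,
        ∀ g : ListDecoder X Y (n k) (numMessages R (n k)), HasListSize L g →
          Real.exp (-(n k * (E + ε))) ≤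
            avgListError W (uniformTypeClass (n k) (Qs k)) g) ∧
      -- the Gallager / Viterbi-Omura bound for the same ensemble has the same exponent
      ExpEq n
        (fun k => gallagerBound W (uniformTypeClass (n k) (Qs k)) (numMessages R (n k)) L)
        (fun k => Real.exp (-(n k * E))) ∧
      -- `E = max_{0 ≤ ρ ≤ L} min_V {D(V‖W|Q) + ρ (I(X;Y) - R)}`
      (∃ F : ℝ → ℝ,
        (∀ ρ ∈ Set.Icc (0 : ℝ) L, IsLeast (rhoObjective W Q R ρ '' channels X Y) (F ρ : EReal)) ∧
        IsGreatest (F '' Set.Icc (0 : ℝ) L) E) ∧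
      -- `E = min_V max_{0 ≤ ρ ≤ L} {D(V‖W|Q) + ρ (I(X;Y) - R)}`
      (∃ G : (X → Y → ℝ) → EReal,
        (∀ V ∈ channels X Y,
          IsGreatest ((fun ρ : ℝ => rhoObjective W Q R ρ V) '' Set.Icc (0 : ℝ) L) (G V)) ∧
        IsLeast (G '' channels X Y) (E : EReal)) := by
  have hQ0 : ∀ x, 0 ≤ Q x := hQ.1
  obtain ⟨P₀, hP₀, ρ₀, hρ₀, hsad⟩ := exists_saddle hW hQ0 R L
  -- The saddle coupling also minimizes D + L[I-R]₊, so its value is the exponent E.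
  have hmin : ∀ P ∈ coupl W Q, listExp W R L P₀ ≤ listExp W R L P := fun P hP =>
    (hsad P hP).trans (rhoExp_le_listExp hρ₀.1 hρ₀.2 P)
  have hleast : IsLeast (listObjective W Q R L '' channels X Y)
      ((listExp W R L P₀ : ℝ) : EReal) :=
    isLeast_image_channels hW hQ0 (fun V hV h => listObjective_eq hQ0 R L hV h)
      (fun V h => listObjective_eq_top R L h) hP₀ hmin
  have hlower := fun ε (hε : (0 : ℝ) < ε) =>
    eventually_le_avgListError hW hR hL hn hQs hQlim hP₀ hε
  have hupper := fun ε (hε : (0 : ℝ) < ε) =>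
    eventually_avgListError_le hW hR hQ0 hn hQs hQlim hmin hε
  refine ⟨listExp W R L P₀, hleast, fun g hg => ?_, fun g hg => ?_, hlower, ?_, ?_, ?_⟩
  · refine expEq_exp_of_eventually hn (fun ε hε => ?_) fun ε hε => ?_
    · filter_upwards [hlower ε hε, hg] with k hk hgk
      exact hk (g k) hgk.1
    · filter_upwards [hupper ε hε, hg, eventually_mul_le_numMessages hn hR L] with k hk hgk hM
      -- ML is no worse than any decoder of the same list size, so an auxiliary MMI decoder,
      -- available once M ≥ L, transfers its upper bound.
      obtain ⟨g', hg'⟩ := exists_isMMIListDecoder (X := X) (Y := Y) (n := n k) hM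
      exact (hgk.avgListError_le hg'.1 (uniformTypeClass_nonneg _)).trans (hk g' hg')
  · refine expEq_exp_of_eventually hn (fun ε hε => ?_) fun ε hε => ?_
    · filter_upwards [hlower ε hε, hg] with k hk hgk
      exact hk (g k) hgk.1
    · filter_upwards [hupper ε hε, hg] with k hk hgk
      exact hk (g k) hgk
  · exact expEq_exp_of_eventually hn
      (fun ε hε => eventually_le_gallagerBound hW hn hQs hQlim hP₀ hε)
      fun ε hε => eventually_gallagerBound_le hW hR hQ0 hn hQlim hρ₀ hsad hε
  · choose Pm hPm hPmin using fun ρ : ℝ => (isCompact_coupl hW hQ0).exists_isMinOn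
      ⟨_, joint_self_mem_coupl hW hQ0⟩ (continuous_rhoExp W R ρ).continuousOn
    refine ⟨fun ρ => rhoExp W R ρ (Pm ρ), fun ρ _ => ?_, ?_, ?_⟩
    · exact isLeast_image_channels hW hQ0 (fun V hV h => rhoObjective_eq hQ0 R ρ hV h)
        (fun V h => rhoObjective_eq_top R ρ h) (hPm ρ) fun P hP => hPmin ρ hP
    -- At ρ₀ the minimum equals E: the saddle inequality bounds it below, its value at P₀ bounds it
    -- above. For any other ρ the value at P₀ gives the upper bound.
    · refine ⟨ρ₀, hρ₀, le_antisymm ?_ (hsad _ (hPm ρ₀))⟩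
      exact (hPmin ρ₀ hP₀).trans (rhoExp_le_listExp hρ₀.1 hρ₀.2 P₀)
    · rintro _ ⟨ρ, hρ, rfl⟩
      exact (hPmin ρ hP₀).trans (rhoExp_le_listExp hρ.1 hρ.2 P₀)
  · exact ⟨listObjective W Q R L, fun V hV => isGreatest_rhoObjective hQ0 R L hV, hleast⟩
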